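/- Let $d\ge 2$ be an integer. For $k\ge 0$ let $P_k$ be the Legendre polynomial of degree $k$ in dimension $d$ (the Gegenbauer polynomial normalised by $P_k(1)=1$), given on $(-1,1)$ by $$P_k(t)=\Big(-\frac12\Big)^k\frac{\Gamma(\frac{d-1}{2})}{\Gamma(k+\frac{d-1}{2})}(1-t^2)^{(3-d)/2}\Big(\frac{d}{dt}\Big)^k(1-t^2)^{k+(d-3)/2}.$$ For $\kappa:[-1,1]\to\mathbb R$ define the eigenvalues of the dot-product kernel $\kappa(x^\top y)$ on the sphere $\mathbb S^{d-1}$ (with the uniform probability measure) by $$\mu_k=\frac{\omega_{d-2}}{\omega_{d-1}}\int_{-1}^1\kappa(t)P_k(t)(1-t^2)^{(d-3)/2}\,dt,\qquad \omega_{p-1}=\frac{2\pi^{p/2}}{\Gamma(p/2)}.$$ There is a constant $C(d,\nu_1)\neq 0$, defined for integers $d\ge2$ and non-integer $\nu_1>0$ and depending only on $d$ and $\nu_1$, such that the following holds. Let $\kappa$ be $C^\infty$ on $(-1,1)$, let $r\ge 1$, let $0<\nu_1<\dots<\nu_r$ be non-integers, let $c_{j,1},c_{j,-1}$ ($1\le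 j\le r$) be real numbers and let $\epsilon>0$. Assume that for every integer $s\ge 0$ there are polynomials $p_{s,1},p_{s,-1}$ with $$\kappa^{(s)}(t)=p_{s,1}(1-t)+(-1)^s\sum_{j=1}^r c_{j,1}\frac{\Gamma(\nu_j+1)}{\Gamma(\nu_j+1-s)}(1-t)^{\nu_j-s}+O\big((1-t)^{\nu_1+1+\epsilon-s}\big)\quad(t\to1^-),$$ $$\kappa^{(s)}(t)=p_{s,-1}(1+t)+\sum_{j=1}^r c_{j,-1}\frac{\Gamma(\nu_j+1)}{\Gamma(\nu_j+1-s)}(1+t)^{\nu_j-s}+O\big((1+t)^{\nu_1+1+\epsilon-s}\big)\quad(t\to-1^+).$$ (The case $s=0$ is the expansion of $\kappa$ itself.) Then, as $k\to\infty$: - along even $k$: $\mu_k\sim(c_{1,1}+c_{1,-1})\,C(d,\nu_1)\,k^{-d-2\nu_1+1}$ if $c_{1,1}\neq -c_{1,-1}$, and $\mu_k=o(k^{-d-2\nu_1+1})$ if $c_{1,1}=-c_{1,-1}$; - along odd $k$: $\mu_k\sim(c_{1,1}-c_{1,-1})\,C(d,\nu_1)\,k^{-d-2\nu_1+1}$ if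 $c_{1,1}\neq c_{1,-1}$, and $\mu_k=o(k^{-d-2\nu_1+1})$ if $c_{1,1}=c_{1,-1}$. Moreover, for every integer $d\ge2$, if $\kappa$ is $C^\infty$ on the closed interval $[-1,1]$, then $\mu_k$ decays faster than any polynomial: $k^n\mu_k\to0$ for every integer $n\ge 0$. -/

import Mathlib

open Filter Set Asymptotics
open scoped Topology ContDiff Polynomial

noncomputable section

namespace DotProduct

/-- `sphereArea m = 2 π^((m+1)/2) / Γ((m+1)/2)`, the surface area of the unit sphere of
dimension `m`, that is, of the unit sphere of Euclidean space of dimension `m + 1`. -/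
def sphereArea (m : ℝ) : ℝ :=
  2 * Real.pi ^ ((m + 1) / 2) / Real.Gamma ((m + 1) / 2)

/-- The Legendre polynomial of degree `k` in dimension `d`, normalised by the value `1` at `1`,
given on the open interval `(-1, 1)` by the Rodrigues formula. (Its values are only used on
`(-1, 1)`.) -/
def legendreP (d k : ℕ) (t : ℝ) : ℝ :=
  (-1 / 2) ^ k * (Real.Gamma (((d : ℝ) - 1) / 2) / Real.Gamma ((k : ℝ) + ((d : ℝ) - 1) / 2)) *
    (1 - t ^ 2) ^ ((3 - (d : ℝ)) / 2) *
    iteratedDeriv k (fun u : ℝ => (1 - u ^ 2) ^ ((k : ℝ) + ((d : ℝ) - 3) / 2)) t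

/-- The `k`-th eigenvalue (Legendre coefficient) of the dot-product kernel `κ(⟨x, y⟩)` on the
unit sphere of `ℝ^d` with its uniform probability measure. -/
def mercerEigenvalue (d : ℕ) (κ : ℝ → ℝ) (k : ℕ) : ℝ :=
  sphereArea ((d : ℝ) - 2) / sphereArea ((d : ℝ) - 1) *
    ∫ t in (-1 : ℝ)..1, κ t * legendreP d k t * (1 - t ^ 2) ^ (((d : ℝ) - 3) / 2)

/-- As `t → 1⁻`, the function `κ` is a polynomial in `1 - t` plus `∑ j, c j * (1 - t) ^ ν j`
plus `O((1 - t) ^ ρ)`, and every derivative of `κ` has the expansion obtained by differentiating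
this one (`s = 0` is the expansion of `κ` itself). -/
def HasExpansionAtOne (κ : ℝ → ℝ) {n : ℕ} (ν c : Fin n → ℝ) (ρ : ℝ) : Prop :=
  ∀ s : ℕ, ∃ p : ℝ[X],
    (fun t : ℝ => iteratedDeriv s κ t - (p.eval (1 - t) + (-1) ^ s * ∑ j, c j *
      (Real.Gamma (ν j + 1) / Real.Gamma (ν j + 1 - s)) * (1 - t) ^ (ν j - s)))
      =O[𝓝[<] 1] fun t : ℝ => (1 - t) ^ (ρ - s)

/-- As `t → -1⁺`, the function `κ` is a polynomial in `1 + t` plus `∑ j, c j * (1 + t) ^ ν j`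
plus `O((1 + t) ^ ρ)`, and every derivative of `κ` has the expansion obtained by differentiating
this one (`s = 0` is the expansion of `κ` itself). -/
def HasExpansionAtNegOne (κ : ℝ → ℝ) {n : ℕ} (ν c : Fin n → ℝ) (ρ : ℝ) : Prop :=
  ∀ s : ℕ, ∃ p : ℝ[X],
    (fun t : ℝ => iteratedDeriv s κ t - (p.eval (1 + t) + ∑ j, c j *
      (Real.Gamma (ν j + 1) / Real.Gamma (ν j + 1 - s)) * (1 + t) ^ (ν j - s)))
      =O[𝓝[>] (-1)] fun t : ℝ => (1 + t) ^ (ρ - s)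

/-- The even `k`, tending to infinity. -/
def evenAtTop : Filter ℕ := atTop ⊓ 𝓟 {k | Even k}

/-- The odd `k`, tending to infinity. -/
def oddAtTop : Filter ℕ := atTop ⊓ 𝓟 {k | Odd k}

end DotProduct

end

/-! With `α = (d - 3)/2`, the eigenvalue is a fixed multiple of the integral of `κ` against the
Gegenbauer polynomial for the weight `(1 - t²)^α`. Write `κ` as the sum of its singular powers at
both endpoints and a remainder, and estimate each.

The powers are computed exactly. By the Rodrigues formula, `k` integrations by parts turn the
coefficient of `(1 - t)^ν` into a Beta integral (`integral_one_sub_rpow_mul_gegenbauer`). Euler's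
limit for Γ then gives `powerConst α ν * k^(-(2ν + 2α + 2))`, where `2ν + 2α + 2 = d + 2ν - 1`.
Reflection `t ↦ -t` gives the powers of `1 + t` the same coefficients times `(-1)^k`, whence the
split by parity. Larger exponents decay faster, so only the smallest one is seen.

The remainder has order `ρ = ν 0 + 1 + ε` at both endpoints (`SymbolChain`). The Gegenbauer
polynomials are eigenfunctions, with eigenvalue `k (k + 2α + 1)`, of a second order operator that is
symmetric for the weight. Moving it onto the remainder gains a factor `k^(-2)` and costs only one
order, because its leading coefficient vanishes at the endpoints. Since `|P_k| ≤ 1` (Sonin), `m`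
applications give `O(k^(-2m))` whenever `m < ρ + α + 1` (`SymbolChain.integral_isBigO`). The margin
`1 + ε` leaves room for an integer `m > ν 0 + α + 1`, so the remainder is negligible. A kernel
smooth on the closed interval has every order, hence superpolynomial decay. -/

noncomputable section

namespace DotProduct

open MeasureTheory

/-! ### Gegenbauer polynomials: Rodrigues formula, differential equation, parity, uniform bound. -/

open Polynomial in
/-- The polynomial `Q` with `(d/dt)^k (1 - t²)^(k + α) = (1 - t²)^α * Q t` on `(-1, 1)`. -/
def rodriguesPoly : ℕ → ℝ → ℝ[X]
  | 0, _ => 1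
  | k + 1, α => (1 - X ^ 2) * derivative (rodriguesPoly k (α + 1)) -
      C (2 * (α + 1)) * X * rodriguesPoly k (α + 1)

-- Differentiating the recursion produces the left side of the differential equation for `(k, α +
-- 1)`, up to a multiple of `rodriguesPoly k (α + 1)`.
open Polynomial in
theorem derivative_rodriguesPoly_succ_of_ode {k : ℕ} {α : ℝ}
    (h : (1 - X ^ 2) * derivative (derivative (rodriguesPoly k (α + 1))) -
      C (2 * (α + 1 + 1)) * X * derivative (rodriguesPoly k (α + 1)) +
      C (k * (k + 2 * (α + 1) + 1)) * rodriguesPoly k (α + 1) = 0) :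
    derivative (rodriguesPoly (k + 1) α) =
      -C ((k + 1) * (k + 2 * α + 2)) * rodriguesPoly k (α + 1) := by
  simp only [rodriguesPoly, derivative_sub, derivative_mul, derivative_one, derivative_X_pow,
    derivative_C, derivative_X]
  simp only [map_mul, map_add, map_ofNat, map_natCast, map_one] at h ⊢
  push_cast
  linear_combination h

-- By induction, the equation at `(k, α + 1)` makes the derivative of `rodriguesPoly (k + 1) α` a
-- multiple of `rodriguesPoly k (α + 1)`; inserting this, the equation at `(k + 1, α)` becomes the
-- defining recursion.
open Polynomial in
theorem rodriguesPoly_ode (k : ℕ) (α : ℝ) :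
    (1 - X ^ 2) * derivative (derivative (rodriguesPoly k α)) -
      C (2 * (α + 1)) * X * derivative (rodriguesPoly k α) +
      C (k * (k + 2 * α + 1)) * rodriguesPoly k α = 0 := by
  induction k generalizing α with
  | zero => simp [rodriguesPoly]
  | succ k ih =>
    have h := derivative_rodriguesPoly_succ_of_ode (ih (α + 1))
    rw [h, derivative_mul, derivative_neg, derivative_C]
    simp only [rodriguesPoly]
    simp only [map_mul, map_add, map_ofNat, map_natCast, map_one, Nat.cast_add, Nat.cast_one]
    ring

open Polynomial in
theorem rodriguesPoly_comp_neg (k : ℕ) (α : ℝ) :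
    (rodriguesPoly k α).comp (-X) = (-1) ^ k * rodriguesPoly k α := by
  induction k generalizing α with
  | zero => simp [rodriguesPoly]
  | succ k ih =>
    have h := congrArg derivative (ih (α + 1))
    have h1 : derivative ((-1 : ℝ[X]) ^ k) = 0 := by
      rw [← C_1, ← C_neg, ← C_pow, derivative_C]
    rw [derivative_comp, derivative_mul, h1] at h
    simp only [derivative_neg, derivative_X] at h
    simp only [rodriguesPoly, sub_comp, mul_comp, one_comp, pow_comp, X_comp, C_comp, ih (α + 1)]
    linear_combination -(1 - X ^ 2) * h

theorem rodriguesPoly_eval_one (k : ℕ) {α : ℝ} (hα : -1 < α) :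
    (rodriguesPoly k α).eval 1 =
      (-2) ^ k * (Real.Gamma (k + α + 1) / Real.Gamma (α + 1)) := by
  induction k generalizing α with
  | zero =>
    have := (Real.Gamma_pos_of_pos (by linarith : 0 < α + 1)).ne'
    simp [rodriguesPoly, this]
  | succ k ih =>
    have h0 := (Real.Gamma_pos_of_pos (by linarith : 0 < α + 1)).ne'
    have h1 : α + 1 ≠ 0 := by linarith
    simp only [rodriguesPoly, Polynomial.eval_sub, Polynomial.eval_mul, Polynomial.eval_one,
      Polynomial.eval_pow, Polynomial.eval_X, Polynomial.eval_C, ih (by linarith : -1 < α + 1),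
      Real.Gamma_add_one h1]
    push_cast
    rw [show (k : ℝ) + (α + 1) + 1 = k + 1 + α + 1 by ring]
    field_simp
    ring

theorem one_sub_sq_pos {t : ℝ} (ht : t ∈ Ioo (-1 : ℝ) 1) : 0 < 1 - t ^ 2 := by
  nlinarith [ht.1, ht.2]

theorem hasDerivAt_one_sub_sq_rpow (β : ℝ) {t : ℝ} (ht : t ∈ Ioo (-1 : ℝ) 1) :
    HasDerivAt (fun u : ℝ => (1 - u ^ 2) ^ (β + 1)) (-2 * (β + 1) * t * (1 - t ^ 2) ^ β) t := by
  have h : HasDerivAt (fun u : ℝ => 1 - u ^ 2) (-(2 * t)) t := by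
    simpa using (hasDerivAt_pow 2 t).const_sub 1
  have := h.rpow_const (p := β + 1) (Or.inl (one_sub_sq_pos ht).ne')
  rw [add_sub_cancel_right] at this
  exact this.congr_deriv (by ring)

theorem hasDerivAt_weight_mul_rodriguesPoly (k : ℕ) (α : ℝ) {t : ℝ} (ht : t ∈ Ioo (-1 : ℝ) 1) :
    HasDerivAt (fun u : ℝ => (1 - u ^ 2) ^ (α + 1) * (rodriguesPoly k (α + 1)).eval u)
      ((1 - t ^ 2) ^ α * (rodriguesPoly (k + 1) α).eval t) t := by
  refine ((hasDerivAt_one_sub_sq_rpow α ht).mul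
    ((rodriguesPoly k (α + 1)).hasDerivAt t)).congr_deriv ?_
  rw [Real.rpow_add_one (one_sub_sq_pos ht).ne']
  simp only [rodriguesPoly, Polynomial.eval_sub, Polynomial.eval_mul, Polynomial.eval_one,
      Polynomial.eval_pow, Polynomial.eval_X, Polynomial.eval_C]
  ring

theorem iteratedDeriv_one_sub_sq_rpow (k : ℕ) (α : ℝ) {t : ℝ} (ht : t ∈ Ioo (-1 : ℝ) 1) :
    iteratedDeriv k (fun u : ℝ => (1 - u ^ 2) ^ (k + α)) t =
      (1 - t ^ 2) ^ α * (rodriguesPoly k α).eval t := by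
  induction k generalizing α t with
  | zero => simp [rodriguesPoly]
  | succ k ih =>
    rw [iteratedDeriv_succ]
    have h : (fun u : ℝ => (1 - u ^ 2) ^ (((k + 1 : ℕ) : ℝ) + α)) =
        fun u : ℝ => (1 - u ^ 2) ^ (k + (α + 1)) := by
      funext u
      push_cast
      congr 1
      ring
    rw [h]
    refine (((hasDerivAt_weight_mul_rodriguesPoly k α ht)).congr_of_eventuallyEq ?_).deriv
    filter_upwards [Ioo_mem_nhds ht.1 ht.2] with u hu using ih (α + 1) hu

/-- The Gegenbauer polynomial of degree `k` for the weight `(1 - t²)^α`, with value `1` at `1`. -/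
def gegenbauer (k : ℕ) (α : ℝ) : ℝ[X] :=
  Polynomial.C ((-1 / 2) ^ k * (Real.Gamma (α + 1) / Real.Gamma (k + α + 1))) * rodriguesPoly k α

theorem legendreP_eq_gegenbauer (d k : ℕ) {t : ℝ} (ht : t ∈ Ioo (-1 : ℝ) 1) :
    legendreP d k t = (gegenbauer k (((d : ℝ) - 3) / 2)).eval t := by
  have h : (1 - t ^ 2) ^ ((3 - (d : ℝ)) / 2) * (1 - t ^ 2) ^ (((d : ℝ) - 3) / 2) = 1 := by
    rw [← Real.rpow_add (one_sub_sq_pos ht), show (3 - (d : ℝ)) / 2 + ((d : ℝ) - 3) / 2 = 0 by ring,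
      Real.rpow_zero]
  rw [legendreP, iteratedDeriv_one_sub_sq_rpow k _ ht, gegenbauer, Polynomial.eval_mul,
    Polynomial.eval_C, show ((d : ℝ) - 3) / 2 + 1 = (d - 1) / 2 by ring,
    show (k : ℝ) + ((d : ℝ) - 3) / 2 + 1 = k + (d - 1) / 2 by ring]
  linear_combination ((-1 / 2) ^ k *
    (Real.Gamma (((d : ℝ) - 1) / 2) / Real.Gamma (k + ((d : ℝ) - 1) / 2)) *
    (rodriguesPoly k (((d : ℝ) - 3) / 2)).eval t) * h

theorem gegenbauer_eval_one (k : ℕ) {α : ℝ} (hα : -1 < α) : (gegenbauer k α).eval 1 = 1 := by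
  have h0 := (Real.Gamma_pos_of_pos (by linarith : 0 < α + 1)).ne'
  have h1 := (Real.Gamma_pos_of_pos (by linarith [k.cast_nonneg (α := ℝ)] : 0 < k + α + 1)).ne'
  rw [gegenbauer, Polynomial.eval_mul, Polynomial.eval_C, rodriguesPoly_eval_one k hα]
  have : (-1 / 2 : ℝ) ^ k * (-2) ^ k = 1 := by rw [← mul_pow]; norm_num
  field_simp
  linear_combination this

theorem gegenbauer_eval_neg (k : ℕ) (α t : ℝ) :
    (gegenbauer k α).eval (-t) = (-1) ^ k * (gegenbauer k α).eval t := by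
  have := congrArg (Polynomial.eval t) (rodriguesPoly_comp_neg k α)
  simp only [Polynomial.eval_comp, Polynomial.eval_neg, Polynomial.eval_X, Polynomial.eval_mul,
    Polynomial.eval_pow, Polynomial.eval_one] at this
  rw [gegenbauer, Polynomial.eval_mul, Polynomial.eval_mul, Polynomial.eval_C, Polynomial.eval_C, this]
  ring

theorem gegenbauer_ode (k : ℕ) (α t : ℝ) :
    (1 - t ^ 2) * (gegenbauer k α).derivative.derivative.eval t -
      2 * (α + 1) * t * (gegenbauer k α).derivative.eval t +
      k * (k + 2 * α + 1) * (gegenbauer k α).eval t = 0 := by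
  have := congrArg (Polynomial.eval t) (rodriguesPoly_ode k α)
  simp only [Polynomial.eval_X, Polynomial.eval_mul, Polynomial.eval_sub, Polynomial.eval_add,
    Polynomial.eval_pow, Polynomial.eval_one, Polynomial.eval_C, Polynomial.eval_zero] at this
  simp only [gegenbauer, Polynomial.derivative_C_mul, Polynomial.eval_mul, Polynomial.eval_C]
  linear_combination ((-1 / 2) ^ k * (Real.Gamma (α + 1) / Real.Gamma (k + α + 1))) * this

/-- Sonin's bound. -/
theorem abs_gegenbauer_le_one {k : ℕ} {α : ℝ} (hα : -1 / 2 ≤ α) {t : ℝ}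
    (ht : t ∈ Icc (-1 : ℝ) 1) : |(gegenbauer k α).eval t| ≤ 1 := by
  rcases Nat.eq_zero_or_pos k with rfl | hk
  · have h0 := (Real.Gamma_pos_of_pos (by linarith : 0 < α + 1)).ne'
    simp [gegenbauer, rodriguesPoly, h0]
  set y := gegenbauer k α with hy
  have hk' : (0 : ℝ) < k := by exact_mod_cast hk
  set l : ℝ := k * (k + 2 * α + 1) with hl
  have hl0 : 0 < l := by rw [hl]; exact mul_pos hk' (by linarith)
  have key : ∀ s ∈ Icc (0 : ℝ) 1, y.eval s ^ 2 ≤ 1 := by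
    -- Sonin's function: by the differential equation its derivative is `2 (2α + 1) s y'²`,
    -- nonnegative on `[0, 1]` when `α ≥ -1/2`, and its value at `1` is `l`. Parity handles negative
    -- arguments.
    let E : ℝ → ℝ := fun s => l * y.eval s ^ 2 + (1 - s ^ 2) * y.derivative.eval s ^ 2
    have hE : ∀ s, HasDerivAt E (2 * (2 * α + 1) * s * y.derivative.eval s ^ 2) s := by
      intro s
      have h1 := y.hasDerivAt s
      have h2 := y.derivative.hasDerivAt s
      have h3 : HasDerivAt (fun u : ℝ => 1 - u ^ 2) (-(2 * s)) s := by
        simpa using (hasDerivAt_pow 2 s).const_sub 1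
      refine (((h1.pow 2).const_mul l).add (h3.mul (h2.pow 2))).congr_deriv ?_
      have := gegenbauer_ode k α s
      simp only [Nat.cast_ofNat, Nat.add_one_sub_one, pow_one, Pi.pow_apply]
      linear_combination 2 * y.derivative.eval s * this
    have hmono : MonotoneOn E (Icc 0 1) := by
      refine monotoneOn_of_hasDerivWithinAt_nonneg (convex_Icc 0 1)
        (fun s _ => (hE s).continuousAt.continuousWithinAt)
        (fun s _ => (hE s).hasDerivWithinAt) fun s hs => ?_
      rw [interior_Icc] at hs
      have : 0 ≤ 2 * α + 1 := by linarith
      have := hs.1.le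
      positivity
    intro s hs
    have h := hmono hs (right_mem_Icc.2 zero_le_one) hs.2
    have h1 : y.eval 1 = 1 := gegenbauer_eval_one k (by linarith)
    simp only [E, h1] at h
    have h2 : 0 ≤ (1 - s ^ 2) * y.derivative.eval s ^ 2 :=
      mul_nonneg (by nlinarith [hs.1, hs.2]) (sq_nonneg _)
    have : l * y.eval s ^ 2 ≤ l * 1 := by linarith
    exact le_of_mul_le_mul_left this hl0
  rw [← sq_le_one_iff_abs_le_one]
  rcases le_total 0 t with h | h
  · exact key t ⟨h, ht.2⟩
  · have := key (-t) ⟨by linarith, by linarith [ht.1]⟩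
    rw [hy, gegenbauer_eval_neg, mul_pow, ← pow_mul, mul_comm k, pow_mul, neg_one_sq,
      one_pow, one_mul] at this
    exact this

/-! ### Integrability of the weights, Beta integrals, domination on `(-1, 1)`. -/

theorem intervalIntegral_congr_Ioo {f g : ℝ → ℝ} {a b : ℝ} (hab : a ≤ b)
    (h : EqOn f g (Ioo a b)) : ∫ t in a..b, f t = ∫ t in a..b, g t := by
  rw [intervalIntegral.integral_of_le hab, intervalIntegral.integral_of_le hab,
    integral_Ioc_eq_integral_Ioo, integral_Ioc_eq_integral_Ioo]
  exact setIntegral_congr_fun measurableSet_Ioo h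

theorem uIoo_neg_one_one : uIoo (-1 : ℝ) 1 = Ioo (-1) 1 := by
  rw [uIoo_of_le (by norm_num)]

theorem intervalIntegrable_one_sub_rpow_mul_one_add_rpow {a b : ℝ} (ha : -1 < a) (hb : -1 < b) :
    IntervalIntegrable (fun t : ℝ => (1 - t) ^ a * (1 + t) ^ b) volume (-1) 1 := by
  have key : ∀ {a b : ℝ}, -1 < b →
      IntervalIntegrable (fun t : ℝ => (1 - t) ^ a * (1 + t) ^ b) volume (-1) 0 := by
    intro a b hb
    have h := (intervalIntegral.intervalIntegrable_rpow' (a := 0) (b := 1) hb).comp_add_left 1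
    norm_num at h
    refine h.continuousOn_mul fun t ht => ?_
    rw [uIcc_of_le (by norm_num)] at ht
    refine ContinuousAt.continuousWithinAt (ContinuousAt.rpow_const (by fun_prop) (Or.inl ?_))
    linarith [ht.2]
  refine (key hb).trans ?_
  have h := (IntervalIntegrable.iff_comp_neg enorm_ne_top).1 (key (a := b) ha)
  simp only [neg_neg, neg_zero, sub_neg_eq_add, ← sub_eq_add_neg] at h
  exact h.symm.congr_uIoo fun t _ => mul_comm _ _

theorem integral_rpow_mul_one_sub_rpow {a b : ℝ} (ha : -1 < a) (hb : -1 < b) :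
    ∫ t in (0 : ℝ)..1, t ^ b * (1 - t) ^ a =
      Real.Gamma (a + 1) * Real.Gamma (b + 1) / Real.Gamma (a + b + 2) := by
  have h := ProbabilityTheory.beta_eq_betaIntegralReal (b + 1) (a + 1) (by linarith) (by linarith)
  have h2 : Complex.betaIntegral ((b + 1 : ℝ) : ℂ) ((a + 1 : ℝ) : ℂ) =
      ((∫ t in (0 : ℝ)..1, t ^ b * (1 - t) ^ a : ℝ) : ℂ) := by
    rw [Complex.betaIntegral, ← intervalIntegral.integral_ofReal]
    refine intervalIntegral.integral_congr fun t ht => ?_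
    rw [uIcc_of_le zero_le_one] at ht
    rw [Complex.ofReal_mul, Complex.ofReal_cpow ht.1, Complex.ofReal_cpow (by linarith [ht.2])]
    push_cast
    simp
  rw [h2, Complex.ofReal_re, ProbabilityTheory.beta] at h
  rw [← h, mul_comm (Real.Gamma (a + 1)), show b + 1 + (a + 1) = a + b + 2 by ring]

theorem integral_one_sub_rpow_mul_one_add_rpow {a b : ℝ} (ha : -1 < a) (hb : -1 < b) :
    ∫ t in (-1 : ℝ)..1, (1 - t) ^ a * (1 + t) ^ b =
      2 ^ (a + b + 1) * (Real.Gamma (a + 1) * Real.Gamma (b + 1) / Real.Gamma (a + b + 2)) := by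
  have h := intervalIntegral.integral_comp_div_add (a := -1) (b := 1)
    (fun t : ℝ => t ^ b * (1 - t) ^ a) (two_ne_zero (α := ℝ)) (1 / 2)
  rw [show (-1 : ℝ) / 2 + 1 / 2 = 0 by norm_num, show (1 : ℝ) / 2 + 1 / 2 = 1 by norm_num,
    integral_rpow_mul_one_sub_rpow ha hb, smul_eq_mul] at h
  rw [Real.rpow_add_one two_ne_zero, mul_assoc, ← h, ← intervalIntegral.integral_const_mul]
  refine intervalIntegral_congr_Ioo (by norm_num) fun t ht => ?_
  rw [show t / 2 + 1 / 2 = (1 + t) / 2 by ring, show 1 - (1 + t) / 2 = (1 - t) / 2 by ring,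
    Real.div_rpow (by linarith [ht.1]) two_pos.le, Real.div_rpow (by linarith [ht.2]) two_pos.le,
    Real.rpow_add two_pos]
  have h1 := (Real.rpow_pos_of_pos two_pos a).ne'
  have h2 := (Real.rpow_pos_of_pos two_pos b).ne'
  field_simp

theorem one_sub_sq_rpow {t : ℝ} (ht : t ∈ Ioo (-1 : ℝ) 1) (β : ℝ) :
    (1 - t ^ 2) ^ β = (1 - t) ^ β * (1 + t) ^ β := by
  rw [← Real.mul_rpow (by linarith [ht.2]) (by linarith [ht.1])]
  congr 1
  ring

theorem intervalIntegrable_weight {β : ℝ} (hβ : -1 < β) :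
    IntervalIntegrable (fun t : ℝ => (1 - t ^ 2) ^ β) volume (-1) 1 := by
  refine (intervalIntegrable_one_sub_rpow_mul_one_add_rpow hβ hβ).congr_uIoo fun t ht => ?_
  rw [uIoo_neg_one_one] at ht
  exact (one_sub_sq_rpow ht β).symm

theorem intervalIntegrable_of_abs_le {f g : ℝ → ℝ} (hf : ContinuousOn f (Ioo (-1) 1))
    (hg : IntervalIntegrable g volume (-1) 1) (h : ∀ t ∈ Ioo (-1 : ℝ) 1, |f t| ≤ g t) :
    IntervalIntegrable f volume (-1) 1 := by
  have hle : (-1 : ℝ) ≤ 1 := by norm_num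
  rw [intervalIntegrable_iff_integrableOn_Ioc_of_le hle, integrableOn_Ioc_iff_integrableOn_Ioo]
    at hg ⊢
  exact hg.mono' (hf.aestronglyMeasurable measurableSet_Ioo)
    ((ae_restrict_iff' measurableSet_Ioo).2 (Eventually.of_forall h))

theorem abs_integral_le_of_abs_le {f g : ℝ → ℝ} (hg : IntervalIntegrable g volume (-1) 1)
    (h : ∀ t ∈ Ioo (-1 : ℝ) 1, |f t| ≤ g t) :
    |∫ t in (-1 : ℝ)..1, f t| ≤ ∫ t in (-1 : ℝ)..1, g t := by
  have hle : (-1 : ℝ) ≤ 1 := by norm_num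
  rw [intervalIntegrable_iff_integrableOn_Ioc_of_le hle, integrableOn_Ioc_iff_integrableOn_Ioo]
    at hg
  rw [intervalIntegral.integral_of_le hle, intervalIntegral.integral_of_le hle,
    integral_Ioc_eq_integral_Ioo, integral_Ioc_eq_integral_Ioo]
  rw [← Real.norm_eq_abs]
  refine norm_integral_le_of_norm_le hg
    ((ae_restrict_iff' measurableSet_Ioo).2 (Eventually.of_forall fun t ht => ?_))
  exact h t ht

theorem exists_abs_eval_le (p : ℝ[X]) : ∃ M, 0 ≤ M ∧ ∀ t ∈ Ioo (-1 : ℝ) 1, |p.eval t| ≤ M := by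
  obtain ⟨M, hM⟩ := isCompact_Icc.exists_bound_of_continuousOn (s := Icc (-1 : ℝ) 1)
    p.continuous.continuousOn
  exact ⟨M, (norm_nonneg _).trans (hM 0 (by norm_num)), fun t ht => hM t (Ioo_subset_Icc_self ht)⟩

theorem one_sub_sq_le_one (t : ℝ) : 1 - t ^ 2 ≤ 1 := by nlinarith [sq_nonneg t]

theorem weight_anti {t : ℝ} (ht : t ∈ Ioo (-1 : ℝ) 1) {β γ : ℝ} (h : β ≤ γ) :
    (1 - t ^ 2) ^ γ ≤ (1 - t ^ 2) ^ β :=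
  Real.rpow_le_rpow_of_exponent_ge (one_sub_sq_pos ht) (one_sub_sq_le_one t) h

theorem tendsto_one_sub_sq_right : Tendsto (fun t : ℝ => 1 - t ^ 2) (𝓝[<] 1) (𝓝 0) := by
  have : ContinuousAt (fun t : ℝ => 1 - t ^ 2) 1 := by fun_prop
  simpa [ContinuousAt] using this.tendsto.mono_left nhdsWithin_le_nhds

theorem tendsto_one_sub_sq_left : Tendsto (fun t : ℝ => 1 - t ^ 2) (𝓝[>] (-1)) (𝓝 0) := by
  have : ContinuousAt (fun t : ℝ => 1 - t ^ 2) (-1) := by fun_prop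
  simpa [ContinuousAt] using this.tendsto.mono_left nhdsWithin_le_nhds

/-! ### Functions of finite order at the endpoints and the decay of their coefficients. -/

/-- A function on `(-1, 1)` (the `0`-th term) together with its successive derivatives, such that
the derivative of order `s` is `O(1 + (1 - t²)^(ρ - s))`. -/
structure SymbolChain (ρ : ℝ) (F : ℕ → ℝ → ℝ) : Prop where
  hasDerivAt : ∀ s, ∀ t ∈ Ioo (-1 : ℝ) 1, HasDerivAt (F s) (F (s + 1) t) t
  bound : ∀ s : ℕ, ∃ C, ∀ t ∈ Ioo (-1 : ℝ) 1, |F s t| ≤ C * (1 + (1 - t ^ 2) ^ (ρ - s))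

/-- The successive derivatives of `-(1 - t²) f'' + (2 α + 2) t f'`, in terms of those of `f`. -/
def sphereOp (α : ℝ) (F : ℕ → ℝ → ℝ) (s : ℕ) (t : ℝ) : ℝ :=
  -(1 - t ^ 2) * F (s + 2) t + (2 * α + 2 + 2 * s) * t * F (s + 1) t +
    s * (s + 2 * α + 1) * F s t

namespace SymbolChain

variable {ρ : ℝ} {F : ℕ → ℝ → ℝ}

theorem exists_bound_nonneg (hF : SymbolChain ρ F) (s : ℕ) {σ : ℝ} (hσ : σ ≤ ρ - s) : ∃ C, 0 ≤ C ∧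
    ∀ t ∈ Ioo (-1 : ℝ) 1, |F s t| ≤ C * (1 + (1 - t ^ 2) ^ σ) := by
  obtain ⟨C, hC⟩ := hF.bound s
  refine ⟨|C|, abs_nonneg C, fun t ht => (hC t ht).trans ?_⟩
  have h1 := weight_anti ht hσ
  have h2 := Real.rpow_nonneg (one_sub_sq_pos ht).le (ρ - s)
  exact mul_le_mul (le_abs_self C) (by linarith) (by linarith) (abs_nonneg C)

theorem continuousOn (hF : SymbolChain ρ F) (s : ℕ) : ContinuousOn (F s) (Ioo (-1) 1) :=
  fun t ht => (hF.hasDerivAt s t ht).continuousAt.continuousWithinAt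

/-- Two derivatives lose two orders, but the factor `1 - t²` in front of the second one returns an
order; the net loss is one. -/
theorem sphereOp (hF : SymbolChain ρ F) (α : ℝ) : SymbolChain (ρ - 1) (sphereOp α F) where
  hasDerivAt s t ht := by
    have h2 := hF.hasDerivAt (s + 2) t ht
    have h1 := hF.hasDerivAt (s + 1) t ht
    have h0 := hF.hasDerivAt s t ht
    have hq : HasDerivAt (fun u : ℝ => -(1 - u ^ 2)) (2 * t) t := by
      exact ((hasDerivAt_pow 2 t).const_sub 1).neg.congr_deriv (by simp)
    have hl : HasDerivAt (fun u : ℝ => (2 * α + 2 + 2 * s) * u) (2 * α + 2 + 2 * s) t := by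
      simpa using (hasDerivAt_id t).const_mul (2 * α + 2 + 2 * (s : ℝ))
    refine (((hq.mul h2).add (hl.mul h1)).add
      (h0.const_mul ((s : ℝ) * (s + 2 * α + 1)))).congr_deriv ?_
    simp only [DotProduct.sphereOp, show s + 1 + 2 = s + 2 + 1 by ring]
    push_cast
    ring
  bound s := by
    obtain ⟨C2, hC2, h2⟩ := hF.exists_bound_nonneg (s + 2) (σ := ρ - 1 - s - 1)
      (by push_cast; linarith)
    obtain ⟨C1, hC1, h1⟩ := hF.exists_bound_nonneg (s + 1) (σ := ρ - 1 - s)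
      (by push_cast; linarith)
    obtain ⟨C0, hC0, h0⟩ := hF.exists_bound_nonneg s (σ := ρ - 1 - s) (by linarith)
    refine ⟨C2 + |2 * α + 2 + 2 * s| * C1 + |s * (s + 2 * α + 1)| * C0, fun t ht => ?_⟩
    have hx := one_sub_sq_pos ht
    have ht1 : |t| ≤ 1 := abs_le.2 ⟨ht.1.le, ht.2.le⟩
    have e2 : |-(1 - t ^ 2) * F (s + 2) t| ≤ C2 * (1 + (1 - t ^ 2) ^ (ρ - 1 - s)) := by
      rw [abs_mul, abs_neg, abs_of_pos hx]
      calc (1 - t ^ 2) * |F (s + 2) t|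
          ≤ (1 - t ^ 2) * (C2 * (1 + (1 - t ^ 2) ^ (ρ - 1 - s - 1))) :=
            mul_le_mul_of_nonneg_left (h2 t ht) hx.le
        _ = C2 * ((1 - t ^ 2) + (1 - t ^ 2) ^ (ρ - 1 - s)) := by
            rw [Real.rpow_sub_one hx.ne']
            field_simp
        _ ≤ _ := mul_le_mul_of_nonneg_left (by linarith [one_sub_sq_le_one t]) hC2
    have e1 : |(2 * α + 2 + 2 * s) * t * F (s + 1) t| ≤
        |2 * α + 2 + 2 * s| * C1 * (1 + (1 - t ^ 2) ^ (ρ - 1 - s)) := by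
      rw [abs_mul, abs_mul, mul_assoc, mul_assoc]
      refine mul_le_mul_of_nonneg_left ?_ (abs_nonneg _)
      exact (mul_le_of_le_one_left (abs_nonneg _) ht1).trans (h1 t ht)
    have e0 : |s * (s + 2 * α + 1) * F s t| ≤
        |s * (s + 2 * α + 1)| * C0 * (1 + (1 - t ^ 2) ^ (ρ - 1 - s)) := by
      rw [abs_mul, mul_assoc]
      exact mul_le_mul_of_nonneg_left (h0 t ht) (abs_nonneg _)
    rw [DotProduct.sphereOp]
    refine (abs_add_le _ _).trans ?_
    have := abs_add_le (-(1 - t ^ 2) * F (s + 2) t) ((2 * α + 2 + 2 * s) * t * F (s + 1) t)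
    calc _ ≤ C2 * (1 + (1 - t ^ 2) ^ (ρ - 1 - s)) +
          |2 * α + 2 + 2 * s| * C1 * (1 + (1 - t ^ 2) ^ (ρ - 1 - s)) +
          |s * (s + 2 * α + 1)| * C0 * (1 + (1 - t ^ 2) ^ (ρ - 1 - s)) :=
          add_le_add (this.trans (add_le_add e2 e1)) e0
      _ = _ := by ring

variable {α : ℝ}

theorem weight_continuousOn (α : ℝ) : ContinuousOn (fun t : ℝ => (1 - t ^ 2) ^ α) (Ioo (-1) 1) :=
  ContinuousOn.rpow_const (by fun_prop) fun _ ht => Or.inl (one_sub_sq_pos ht).ne'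

theorem exists_integrable_bound (hF : SymbolChain ρ F) (hα : -1 < α) (h : -1 < ρ + α) :
    ∃ g : ℝ → ℝ, IntervalIntegrable g volume (-1) 1 ∧
      ∀ t ∈ Ioo (-1 : ℝ) 1, |F 0 t * (1 - t ^ 2) ^ α| ≤ g t := by
  obtain ⟨C, -, hC⟩ := hF.exists_bound_nonneg 0 (σ := ρ) (by simp)
  refine ⟨fun t => C * ((1 - t ^ 2) ^ α + (1 - t ^ 2) ^ (ρ + α)),
    ((intervalIntegrable_weight hα).add (intervalIntegrable_weight h)).const_mul C,
    fun t ht => ?_⟩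
  have hx := Real.rpow_nonneg (one_sub_sq_pos ht).le α
  rw [abs_mul, abs_of_nonneg hx]
  simp only
  rw [Real.rpow_add (one_sub_sq_pos ht)]
  exact (mul_le_mul_of_nonneg_right (hC t ht) hx).trans_eq (by ring)

theorem intervalIntegrable (hF : SymbolChain ρ F) (hα : -1 < α) (h : -1 < ρ + α) (p : ℝ[X]) :
    IntervalIntegrable (fun t => F 0 t * p.eval t * (1 - t ^ 2) ^ α) volume (-1) 1 := by
  obtain ⟨g, hg, hle⟩ := hF.exists_integrable_bound hα h
  have : IntervalIntegrable (fun t => F 0 t * (1 - t ^ 2) ^ α) volume (-1) 1 :=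
    intervalIntegrable_of_abs_le ((hF.continuousOn 0).mul (weight_continuousOn α)) hg hle
  refine (this.mul_continuousOn (g := fun t => p.eval t)
    p.continuous.continuousOn).congr_uIoo fun t _ => ?_
  simp only
  ring

/-- The boundary terms vanish in Green's formula for the operator `sphereOp`. -/
theorem tendsto_boundary (hF : SymbolChain ρ F) (hα : -1 < α) (h : 0 < ρ + α) (p q : ℝ[X])
    {l : Filter ℝ} (hl : ∀ᶠ t in l, t ∈ Ioo (-1 : ℝ) 1)
    (hl0 : Tendsto (fun t : ℝ => 1 - t ^ 2) l (𝓝 0)) :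
    Tendsto (fun t => (1 - t ^ 2) ^ (α + 1) * (F 0 t * p.eval t - F 1 t * q.eval t)) l (𝓝 0) := by
  obtain ⟨C0, hC0, h0⟩ := hF.exists_bound_nonneg 0 (σ := ρ - 1) (by simp)
  obtain ⟨C1, hC1, h1⟩ := hF.exists_bound_nonneg 1 (σ := ρ - 1) (by simp)
  obtain ⟨M, hM, hp⟩ := exists_abs_eval_le p
  obtain ⟨N, hN, hq⟩ := exists_abs_eval_le q
  -- The bounds of order `ρ - 1` for both `F 0` and `F 1`, times the weight of exponent `α + 1`,
  -- leave the exponents `α + 1` and `ρ + α`, both positive.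
  have lim : Tendsto (fun t : ℝ => (C0 * M + C1 * N) *
      ((1 - t ^ 2) ^ (α + 1) + (1 - t ^ 2) ^ (ρ + α))) l (𝓝 0) := by
    have a := hl0.rpow_const (p := α + 1) (Or.inr (by linarith))
    have b := hl0.rpow_const (p := ρ + α) (Or.inr h.le)
    rw [Real.zero_rpow (by linarith)] at a
    rw [Real.zero_rpow h.ne'] at b
    simpa using (a.add b).const_mul (C0 * M + C1 * N)
  refine squeeze_zero_norm' ?_ lim
  filter_upwards [hl] with t ht
  have hx := one_sub_sq_pos ht
  have hw := Real.rpow_nonneg hx.le (α + 1)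
  have hw' := Real.rpow_nonneg hx.le (ρ - 1)
  rw [Real.norm_eq_abs, abs_mul, abs_of_nonneg hw]
  have e : |F 0 t * p.eval t - F 1 t * q.eval t| ≤
      (C0 * M + C1 * N) * (1 + (1 - t ^ 2) ^ (ρ - 1)) := by
    refine (abs_sub _ _).trans ?_
    rw [abs_mul, abs_mul]
    have a := mul_le_mul (h0 t ht) (hp t ht) (abs_nonneg _) (by positivity)
    have b := mul_le_mul (h1 t ht) (hq t ht) (abs_nonneg _) (by positivity)
    linarith
  refine (mul_le_mul_of_nonneg_left e hw).trans_eq ?_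
  rw [show ρ + α = (α + 1) + (ρ - 1) by ring, Real.rpow_add hx (α + 1)]
  ring

/-- Green's formula: at `s = 0` the operator is the Sturm–Liouville operator for the weight `(1 -
t²)^α`, and the Gegenbauer polynomial is its eigenfunction. The condition `0 < ρ + α` kills the
boundary terms. -/
theorem integral_sphereOp (hF : SymbolChain ρ F) (hα : -1 < α) (h : 0 < ρ + α) (k : ℕ) :
    k * (k + 2 * α + 1) *
        ∫ t in (-1 : ℝ)..1, F 0 t * (gegenbauer k α).eval t * (1 - t ^ 2) ^ α =
      ∫ t in (-1 : ℝ)..1,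
        DotProduct.sphereOp α F 0 t * (gegenbauer k α).eval t * (1 - t ^ 2) ^ α := by
  set y := gegenbauer k α
  have i1 := hF.intervalIntegrable hα (by linarith) y
  have i2 := (hF.sphereOp α).intervalIntegrable hα (by linarith) y
  have hd : ∀ t ∈ Ioo (-1 : ℝ) 1, HasDerivAt
      (fun t => (1 - t ^ 2) ^ (α + 1) * (F 0 t * y.derivative.eval t - F 1 t * y.eval t))
      (DotProduct.sphereOp α F 0 t * y.eval t * (1 - t ^ 2) ^ α -
        k * (k + 2 * α + 1) * (F 0 t * y.eval t * (1 - t ^ 2) ^ α)) t := by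
    intro t ht
    refine ((hasDerivAt_one_sub_sq_rpow α ht).mul
      (((hF.hasDerivAt 0 t ht).mul (y.derivative.hasDerivAt t)).sub
      ((hF.hasDerivAt 1 t ht).mul (y.hasDerivAt t)))).congr_deriv ?_
    simp only [DotProduct.sphereOp, zero_add, Nat.cast_zero, Pi.mul_apply, Pi.sub_apply,
      Nat.reduceAdd]
    rw [Real.rpow_add_one (one_sub_sq_pos ht).ne']
    linear_combination (1 - t ^ 2) ^ α * F 0 t * gegenbauer_ode k α t
  have key := intervalIntegral.integral_eq_sub_of_hasDerivAt_of_tendsto (by norm_num) hd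
    (i2.sub (i1.const_mul _))
    (hF.tendsto_boundary hα h _ _ (Ioo_mem_nhdsGT (by norm_num)) tendsto_one_sub_sq_left)
    (hF.tendsto_boundary hα h _ _ (Ioo_mem_nhdsLT (by norm_num)) tendsto_one_sub_sq_right)
  rw [intervalIntegral.integral_sub i2 (i1.const_mul _), intervalIntegral.integral_const_mul] at key
  linarith

/-- Apply Green's formula `m` times, then bound the polynomial by `1`. The hypothesis says that the
final order `ρ - m` is still integrable against the weight, which is also the boundary condition for
the last use of Green's formula. -/
theorem exists_pow_mul_abs_integral_le (hF : SymbolChain ρ F) (hα : -1 / 2 ≤ α) (m : ℕ)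
    (h : m < ρ + α + 1) : ∃ C, ∀ k : ℕ, (k * (k + 2 * α + 1)) ^ m *
      |∫ t in (-1 : ℝ)..1, F 0 t * (gegenbauer k α).eval t * (1 - t ^ 2) ^ α| ≤ C := by
  induction m generalizing ρ F with
  | zero =>
    obtain ⟨g, hg, hle⟩ := hF.exists_integrable_bound (α := α) (by linarith)
      (by push_cast at h; linarith)
    refine ⟨∫ t in (-1 : ℝ)..1, g t, fun k => ?_⟩
    rw [pow_zero, one_mul]
    refine abs_integral_le_of_abs_le hg fun t ht => le_trans ?_ (hle t ht)
    rw [mul_right_comm, abs_mul]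
    exact mul_le_of_le_one_right (abs_nonneg _)
      (abs_gegenbauer_le_one hα (Ioo_subset_Icc_self ht))
  | succ m ih =>
    push_cast at h
    obtain ⟨C, hC⟩ := ih (hF.sphereOp α) (by linarith)
    refine ⟨C, fun k => ?_⟩
    have hk : (0 : ℝ) ≤ k * (k + 2 * α + 1) :=
      mul_nonneg k.cast_nonneg (by linarith [k.cast_nonneg (α := ℝ)])
    have := hC k
    rw [← hF.integral_sphereOp (by linarith) (by linarith [m.cast_nonneg (α := ℝ)]) k, abs_mul,
      abs_of_nonneg hk, ← mul_assoc, ← pow_succ] at this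
    exact this

/-- The Gegenbauer coefficients of a function of order `ρ` are `O(k ^ (-2 m))` for
`m < ρ + α + 1`. -/
theorem integral_isBigO (hF : SymbolChain ρ F) (hα : -1 / 2 ≤ α) (m : ℕ) (h : m < ρ + α + 1) :
    (fun k : ℕ => ∫ t in (-1 : ℝ)..1, F 0 t * (gegenbauer k α).eval t * (1 - t ^ 2) ^ α)
      =O[atTop] fun k : ℕ => (k : ℝ) ^ (-(2 * m : ℝ)) := by
  obtain ⟨C, hC⟩ := hF.exists_pow_mul_abs_integral_le hα m h
  refine IsBigO.of_bound C ?_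
  filter_upwards [eventually_gt_atTop 0] with k hk
  have hk' : (0 : ℝ) < k := by exact_mod_cast hk
  rw [Real.rpow_neg hk'.le, Real.norm_eq_abs, Real.norm_eq_abs, abs_inv,
    abs_of_pos (Real.rpow_pos_of_pos hk' _), ← div_eq_mul_inv,
    le_div_iff₀ (Real.rpow_pos_of_pos hk' _), mul_comm]
  refine (mul_le_mul_of_nonneg_right ?_ (abs_nonneg _)).trans (hC k)
  -- It remains to compare `k²` with `k (k + 2α + 1)`, where `2α + 1 ≥ 0`.
  rw [show (2 * m : ℝ) = ((2 * m : ℕ) : ℝ) by push_cast; ring, Real.rpow_natCast, pow_mul]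
  refine pow_le_pow_left₀ (by positivity) ?_ m
  nlinarith

end SymbolChain

/-! ### Exact coefficients of the powers `(1 - t)^ν` and `(1 + t)^ν`. -/

theorem one_sub_rpow_mul_weight {t : ℝ} (ht : t ∈ Ioo (-1 : ℝ) 1) (ν β : ℝ) :
    (1 - t) ^ ν * (1 - t ^ 2) ^ β = (1 - t) ^ (ν + β) * (1 + t) ^ β := by
  rw [one_sub_sq_rpow ht, Real.rpow_add (by linarith [ht.2])]
  ring

theorem intervalIntegrable_one_sub_rpow_mul {α ν : ℝ} (hα : -1 < α) (hν : -1 < ν + α) (p : ℝ[X]) :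
    IntervalIntegrable (fun t => (1 - t) ^ ν * p.eval t * (1 - t ^ 2) ^ α) volume (-1) 1 := by
  refine ((intervalIntegrable_one_sub_rpow_mul_one_add_rpow hν hα).mul_continuousOn
    (g := fun t => p.eval t) p.continuous.continuousOn).congr_uIoo fun t ht => ?_
  rw [uIoo_neg_one_one] at ht
  simp only
  rw [mul_right_comm ((1 - t) ^ ν), one_sub_rpow_mul_weight ht]

/-- One integration by parts. It replaces `(α, ν)` by `(α + 1, ν - 1)` and preserves `ν + α`, so the
integrability condition survives iteration. -/
theorem integral_one_sub_rpow_mul_rodriguesPoly_succ {α ν : ℝ} (hα : -1 < α) (hν : -1 < ν + α)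
    (k : ℕ) :
    ∫ t in (-1 : ℝ)..1, (1 - t) ^ ν * (rodriguesPoly (k + 1) α).eval t * (1 - t ^ 2) ^ α =
      ν * ∫ t in (-1 : ℝ)..1,
        (1 - t) ^ (ν - 1) * (rodriguesPoly k (α + 1)).eval t * (1 - t ^ 2) ^ (α + 1) := by
  set Q := rodriguesPoly k (α + 1)
  have i1 := intervalIntegrable_one_sub_rpow_mul hα hν (rodriguesPoly (k + 1) α)
  have i2 := intervalIntegrable_one_sub_rpow_mul (α := α + 1) (ν := ν - 1) (by linarith)
    (by linarith) Q
  have hd : ∀ t ∈ Ioo (-1 : ℝ) 1, HasDerivAt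
      (fun t => (1 - t) ^ ν * ((1 - t ^ 2) ^ (α + 1) * Q.eval t))
      ((1 - t) ^ ν * (rodriguesPoly (k + 1) α).eval t * (1 - t ^ 2) ^ α -
        ν * ((1 - t) ^ (ν - 1) * Q.eval t * (1 - t ^ 2) ^ (α + 1))) t := by
    intro t ht
    have h1 : HasDerivAt (fun u : ℝ => 1 - u) (-1) t := by
      simpa using (hasDerivAt_id t).const_sub 1
    have h2 := h1.rpow_const (p := ν) (Or.inl (by linarith [ht.2]))
    refine (h2.mul (hasDerivAt_weight_mul_rodriguesPoly k α ht)).congr_deriv ?_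
    ring
  -- The boundary term, rewritten with positive exponents at both endpoints, extends continuously
  -- and vanishes there.
  have hG : Continuous fun t : ℝ => (1 - t) ^ (ν + (α + 1)) * (1 + t) ^ (α + 1) * Q.eval t := by
    refine ((Continuous.rpow_const (by fun_prop) fun _ => Or.inr (by linarith)).mul
      (Continuous.rpow_const (by fun_prop) fun _ => Or.inr (by linarith))).mul Q.continuous
  have heq : ∀ t ∈ Ioo (-1 : ℝ) 1, (1 - t) ^ (ν + (α + 1)) * (1 + t) ^ (α + 1) * Q.eval t =
      (1 - t) ^ ν * ((1 - t ^ 2) ^ (α + 1) * Q.eval t) := by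
    intro t ht
    rw [← one_sub_rpow_mul_weight ht, mul_assoc]
  have hz : (0 : ℝ) ^ (α + 1) = 0 := Real.zero_rpow (by linarith)
  have hz' : (0 : ℝ) ^ (ν + (α + 1)) = 0 := Real.zero_rpow (by linarith)
  have key := intervalIntegral.integral_eq_sub_of_hasDerivAt_of_tendsto (fa := 0) (fb := 0)
    (by norm_num) hd (i1.sub (i2.const_mul _))
    (((hG.tendsto' (-1) 0 (by simp [hz])).mono_left nhdsWithin_le_nhds).congr'
      (eventually_of_mem (Ioo_mem_nhdsGT (by norm_num)) heq))
    (((hG.tendsto' 1 0 (by simp [hz'])).mono_left nhdsWithin_le_nhds).congr'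
      (eventually_of_mem (Ioo_mem_nhdsLT (by norm_num)) heq))
  rw [intervalIntegral.integral_sub i1 (i2.const_mul _), intervalIntegral.integral_const_mul] at key
  linarith

theorem integral_one_sub_rpow_mul_rodriguesPoly {α ν : ℝ} (hα : -1 < α) (hν : -1 < ν + α)
    (k : ℕ) :
    ∫ t in (-1 : ℝ)..1, (1 - t) ^ ν * (rodriguesPoly k α).eval t * (1 - t ^ 2) ^ α =
      (∏ i ∈ Finset.range k, (ν - i)) * (2 ^ (ν + 2 * α + k + 1) *
        (Real.Gamma (ν + α + 1) * Real.Gamma (k + α + 1) / Real.Gamma (ν + 2 * α + 2 + k))) := by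
  induction k generalizing α ν with
  | zero =>
    simp only [Finset.range_zero, Finset.prod_empty, one_mul, Nat.cast_zero, zero_add, add_zero]
    have h := integral_one_sub_rpow_mul_one_add_rpow hν hα
    rw [show ν + α + α = ν + 2 * α by ring] at h
    rw [← h]
    refine intervalIntegral_congr_Ioo (by norm_num) fun t ht => ?_
    simp only [rodriguesPoly, Polynomial.eval_one, mul_one]
    exact one_sub_rpow_mul_weight ht _ _
  | succ k ih =>
    rw [integral_one_sub_rpow_mul_rodriguesPoly_succ hα hν, ih (by linarith) (by linarith),
      Finset.prod_range_succ']
    push_cast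
    rw [show ν - 1 + 2 * (α + 1) + k + 1 = ν + 2 * α + (k + 1) + 1 by ring,
      show ν - 1 + (α + 1) + 1 = ν + α + 1 by ring, show k + (α + 1) + 1 = k + 1 + α + 1 by ring,
      show ν - 1 + 2 * (α + 1) + 2 + k = ν + 2 * α + 2 + (k + 1) by ring]
    simp only [sub_sub, add_comm (1 : ℝ)]
    ring

/-- The normalisation cancels `Γ(k + α + 1)` and the factor `2^k`, and its sign turns the falling
product of `ν` into the rising product of `-ν`, the form needed for Euler's limit. -/
theorem integral_one_sub_rpow_mul_gegenbauer {α ν : ℝ} (hα : -1 < α) (hν : -1 < ν + α) (k : ℕ) :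
    ∫ t in (-1 : ℝ)..1, (1 - t) ^ ν * (gegenbauer k α).eval t * (1 - t ^ 2) ^ α =
      2 ^ (ν + 2 * α + 1) * Real.Gamma (α + 1) * Real.Gamma (ν + α + 1) *
        ((∏ i ∈ Finset.range k, (-ν + i)) / Real.Gamma (ν + 2 * α + 2 + k)) := by
  have h := integral_one_sub_rpow_mul_rodriguesPoly hα hν k
  have h1 := (Real.Gamma_pos_of_pos (by linarith [k.cast_nonneg (α := ℝ)] : 0 < k + α + 1)).ne'
  have h2 : ∏ i ∈ Finset.range k, (-ν + i) = (-1) ^ k * ∏ i ∈ Finset.range k, (ν - i) := by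
    have h : ∀ i ∈ Finset.range k, -ν + (i : ℝ) = -1 * (ν - i) := fun i _ => by ring
    rw [Finset.prod_congr rfl h, Finset.prod_mul_distrib, Finset.prod_const, Finset.card_range]
  have h3 : (fun t : ℝ => (1 - t) ^ ν * (gegenbauer k α).eval t * (1 - t ^ 2) ^ α) = fun t =>
      ((-1 / 2) ^ k * (Real.Gamma (α + 1) / Real.Gamma (k + α + 1))) *
        ((1 - t) ^ ν * (rodriguesPoly k α).eval t * (1 - t ^ 2) ^ α) := by
    funext t
    rw [gegenbauer, Polynomial.eval_mul, Polynomial.eval_C]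
    ring
  rw [h3, intervalIntegral.integral_const_mul, h, h2,
    show ν + 2 * α + k + 1 = ν + 2 * α + 1 + k by ring, Real.rpow_add two_pos, Real.rpow_natCast,
    div_pow]
  field_simp

theorem integral_one_add_rpow_mul_gegenbauer (α ν : ℝ) (k : ℕ) :
    ∫ t in (-1 : ℝ)..1, (1 + t) ^ ν * (gegenbauer k α).eval t * (1 - t ^ 2) ^ α =
      (-1) ^ k * ∫ t in (-1 : ℝ)..1, (1 - t) ^ ν * (gegenbauer k α).eval t * (1 - t ^ 2) ^ α := by
  have h := intervalIntegral.integral_comp_neg (a := -1) (b := 1)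
    fun t : ℝ => (1 + t) ^ ν * (gegenbauer k α).eval t * (1 - t ^ 2) ^ α
  rw [neg_neg] at h
  rw [← h, ← intervalIntegral.integral_const_mul]
  refine intervalIntegral.integral_congr fun t _ => ?_
  rw [gegenbauer_eval_neg, neg_sq, ← sub_eq_add_neg]
  ring

theorem intervalIntegrable_one_add_rpow_mul {α ν : ℝ} (hα : -1 < α) (hν : -1 < ν + α) (k : ℕ) :
    IntervalIntegrable (fun t => (1 + t) ^ ν * (gegenbauer k α).eval t * (1 - t ^ 2) ^ α)
      volume (-1) 1 := by
  have h := (IntervalIntegrable.iff_comp_neg enorm_ne_top).1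
    ((intervalIntegrable_one_sub_rpow_mul hα hν (gegenbauer k α)).const_mul ((-1) ^ k))
  rw [neg_neg] at h
  refine h.symm.congr_uIoo fun t _ => ?_
  simp only
  rw [gegenbauer_eval_neg, neg_sq, sub_neg_eq_add]
  have : (-1 : ℝ) ^ k * (-1) ^ k = 1 := by rw [← mul_pow]; norm_num
  linear_combination (1 + t) ^ ν * (gegenbauer k α).eval t * (1 - t ^ 2) ^ α * this

/-! ### Asymptotics of the exact coefficients. -/

/-- Quotient of Euler's limits for `Γ b` and `Γ a`; the powers of `k` leave `k^(b - a)` and the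
factorials cancel. -/
theorem tendsto_rpow_mul_prod_div_prod {a b : ℝ} (ha : ∀ m : ℕ, a ≠ -m) (hb : ∀ m : ℕ, b ≠ -m) :
    Tendsto (fun k : ℕ => (k : ℝ) ^ (b - a) *
      ((∏ i ∈ Finset.range k, (a + i)) / ∏ i ∈ Finset.range k, (b + i)))
      atTop (𝓝 (Real.Gamma b / Real.Gamma a)) := by
  have h1 := (Real.GammaSeq_tendsto_Gamma b).div (Real.GammaSeq_tendsto_Gamma a)
    (Real.Gamma_ne_zero ha)
  -- `Real.GammaSeq` has `k + 1` factors in its denominator; this ratio removes the last one.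
  have h2 : Tendsto (fun k : ℕ => (b + k) / (a + k)) atTop (𝓝 1) := by
    have h3 : ∀ c : ℝ, Tendsto (fun k : ℕ => c / (k : ℝ) + 1) atTop (𝓝 1) := fun c => by
      simpa using (tendsto_const_div_atTop_nhds_zero_nat c).add_const 1
    have h4 := (h3 b).div (h3 a) one_ne_zero
    rw [div_one] at h4
    refine h4.congr' ?_
    filter_upwards [eventually_gt_atTop 0] with k hk
    have hk' : (k : ℝ) ≠ 0 := by exact_mod_cast hk.ne'
    have : a + k ≠ 0 := fun h => ha k (by linarith)
    simp only [Pi.div_apply]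
    field_simp
  have h3 := h1.mul h2
  rw [mul_one] at h3
  refine h3.congr' ?_
  filter_upwards [eventually_gt_atTop 0] with k hk
  have hk' : (0 : ℝ) < k := by exact_mod_cast hk
  have e1 : a + k ≠ 0 := fun h => ha k (by linarith)
  have e2 : b + k ≠ 0 := fun h => hb k (by linarith)
  have e3 : ∏ i ∈ Finset.range k, (a + i) ≠ 0 :=
    Finset.prod_ne_zero_iff.2 fun i _ h => ha i (by linarith)
  have e4 : ∏ i ∈ Finset.range k, (b + i) ≠ 0 :=
    Finset.prod_ne_zero_iff.2 fun i _ h => hb i (by linarith)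
  have e5 := (Real.rpow_pos_of_pos hk' a).ne'
  have e6 : ((k.factorial : ℕ) : ℝ) ≠ 0 := by exact_mod_cast k.factorial_ne_zero
  simp only [Pi.div_apply, Real.GammaSeq, Finset.prod_range_succ]
  rw [Real.rpow_sub hk']
  field_simp

theorem Gamma_add_nat {b : ℝ} (hb : 0 < b) (k : ℕ) :
    Real.Gamma (b + k) = Real.Gamma b * ∏ i ∈ Finset.range k, (b + i) := by
  induction k with
  | zero => simp
  | succ k ih =>
    rw [Finset.prod_range_succ, ← mul_assoc, ← ih, Nat.cast_succ, ← add_assoc,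
      Real.Gamma_add_one (by positivity), mul_comm]

/-- The constant in the asymptotics of the Gegenbauer coefficients of `(1 - t)^ν`. -/
def powerConst (α ν : ℝ) : ℝ :=
  2 ^ (ν + 2 * α + 1) * Real.Gamma (α + 1) * Real.Gamma (ν + α + 1) / Real.Gamma (-ν)

/-- Nonintegrality enters through `1 / Γ(-ν)`, which is zero when `ν` is a natural number, that is,
when `(1 - t)^ν` is a polynomial. -/
theorem powerConst_ne_zero {α ν : ℝ} (hα : -1 < α) (hν : -1 < ν + α) (hν' : ∀ m : ℤ, ν ≠ m) :
    powerConst α ν ≠ 0 := by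
  have h1 := (Real.Gamma_pos_of_pos (by linarith : 0 < α + 1)).ne'
  have h2 := (Real.Gamma_pos_of_pos (by linarith : 0 < ν + α + 1)).ne'
  have h3 := Real.Gamma_ne_zero (s := -ν) fun m h => hν' m (by push_cast; linarith)
  have h4 := (Real.rpow_pos_of_pos two_pos (ν + 2 * α + 1)).ne'
  exact div_ne_zero (mul_ne_zero (mul_ne_zero h4 h1) h2) h3

theorem tendsto_integral_one_sub_rpow_mul_gegenbauer {α ν : ℝ} (hα : -1 < α) (hν : -1 < ν + α)
    (hν' : ∀ m : ℤ, ν ≠ m) :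
    Tendsto (fun k : ℕ => (k : ℝ) ^ (2 * ν + 2 * α + 2) *
      ∫ t in (-1 : ℝ)..1, (1 - t) ^ ν * (gegenbauer k α).eval t * (1 - t ^ 2) ^ α)
      atTop (𝓝 (powerConst α ν)) := by
  have hb : 0 < ν + 2 * α + 2 := by linarith
  have hG := (Real.Gamma_pos_of_pos hb).ne'
  have h := (tendsto_rpow_mul_prod_div_prod (a := -ν) (b := ν + 2 * α + 2)
    (fun m h => hν' m (by push_cast; linarith))
    (fun m h => by linarith [m.cast_nonneg (α := ℝ)])).const_mul
    (2 ^ (ν + 2 * α + 1) * Real.Gamma (α + 1) * Real.Gamma (ν + α + 1) /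
      Real.Gamma (ν + 2 * α + 2))
  have hlim : 2 ^ (ν + 2 * α + 1) * Real.Gamma (α + 1) * Real.Gamma (ν + α + 1) /
      Real.Gamma (ν + 2 * α + 2) * (Real.Gamma (ν + 2 * α + 2) / Real.Gamma (-ν)) =
      powerConst α ν := by
    rw [powerConst]
    field_simp
  rw [hlim] at h
  refine h.congr fun k => ?_
  rw [integral_one_sub_rpow_mul_gegenbauer hα hν, Gamma_add_nat hb,
    show ν + 2 * α + 2 - -ν = 2 * ν + 2 * α + 2 by ring]
  simp only [div_eq_mul_inv, mul_inv]
  ring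

theorem integral_one_sub_rpow_mul_gegenbauer_isLittleO {α ν : ℝ} (hα : -1 < α)
    (hν : -1 < ν + α) (hν' : ∀ m : ℤ, ν ≠ m) :
    (fun k : ℕ => (∫ t in (-1 : ℝ)..1, (1 - t) ^ ν * (gegenbauer k α).eval t * (1 - t ^ 2) ^ α) -
      powerConst α ν * (k : ℝ) ^ (-(2 * ν + 2 * α + 2))) =o[atTop]
      fun k : ℕ => (k : ℝ) ^ (-(2 * ν + 2 * α + 2)) := by
  have h := (tendsto_integral_one_sub_rpow_mul_gegenbauer hα hν hν').sub_const (powerConst α ν)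
  rw [sub_self] at h
  rw [isLittleO_iff_tendsto']
  · refine h.congr' ?_
    filter_upwards [eventually_gt_atTop 0] with k hk
    have hk' : (0 : ℝ) < k := by exact_mod_cast hk
    have := (Real.rpow_pos_of_pos hk' (2 * ν + 2 * α + 2)).ne'
    rw [Real.rpow_neg hk'.le]
    field_simp
  · filter_upwards [eventually_gt_atTop 0] with k hk h0
    exact absurd h0 (Real.rpow_pos_of_pos (by exact_mod_cast hk) _).ne'

theorem rpow_natCast_isLittleO {a b : ℝ} (h : a < b) :
    (fun k : ℕ => (k : ℝ) ^ a) =o[atTop] fun k : ℕ => (k : ℝ) ^ b := by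
  have h0 := (tendsto_rpow_neg_atTop (sub_pos.2 h)).comp (tendsto_natCast_atTop_atTop (R := ℝ))
  rw [isLittleO_iff_tendsto']
  · refine h0.congr' ?_
    filter_upwards [eventually_gt_atTop 0] with k hk
    have hk' : (0 : ℝ) < k := by exact_mod_cast hk
    rw [Function.comp_apply, neg_sub, Real.rpow_sub hk']
  · filter_upwards [eventually_gt_atTop 0] with k hk h0
    exact absurd h0 (Real.rpow_pos_of_pos (by exact_mod_cast hk) _).ne'

/-! ### Splitting off the singular powers of the kernel. -/

/-- The derivative of order `s` of `∑ j, c j * x ^ ν j`. -/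
def powSum {n : ℕ} (ν c : Fin n → ℝ) (s : ℕ) (x : ℝ) : ℝ :=
  ∑ j, c j * (Real.Gamma (ν j + 1) / Real.Gamma (ν j + 1 - s)) * x ^ (ν j - s)

theorem hasDerivAt_powSum {n : ℕ} {ν : Fin n → ℝ} (c : Fin n → ℝ) (hν : ∀ j, ∀ m : ℤ, ν j ≠ m)
    (s : ℕ) {x : ℝ} (hx : 0 < x) : HasDerivAt (powSum ν c s) (powSum ν c (s + 1) x) x := by
  unfold powSum
  refine HasDerivAt.fun_sum fun j _ => ?_
  have h := (Real.hasDerivAt_rpow_const (p := ν j - s) (Or.inl hx.ne')).const_mul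
    (c j * (Real.Gamma (ν j + 1) / Real.Gamma (ν j + 1 - s)))
  refine h.congr_deriv ?_
  -- Nonintegrality keeps `ν j - s` off zero and off the poles of Γ, so `Γ(x + 1) = x Γ(x)` turns
  -- the coefficient of order `s`, times `ν j - s`, into that of order `s + 1`.
  have h0 : ν j - s ≠ 0 := fun h => hν j s (by push_cast; linarith)
  have hG : Real.Gamma (ν j - s) ≠ 0 := Real.Gamma_ne_zero fun m hm =>
    hν j (s - m) (by push_cast; linarith)
  rw [show ν j + 1 - s = ν j - s + 1 by ring, Real.Gamma_add_one h0]
  push_cast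
  rw [show ν j + 1 - (s + 1) = ν j - s by ring, show ν j - (s + 1) = ν j - s - 1 by ring]
  field_simp

theorem continuousAt_powSum {n : ℕ} (ν c : Fin n → ℝ) (s : ℕ) {x : ℝ} (hx : x ≠ 0) :
    ContinuousAt (powSum ν c s) x := by
  unfold powSum
  exact tendsto_finsetSum _ fun j _ =>
    (Real.continuousAt_rpow_const _ _ (Or.inl hx)).const_mul _

theorem powSum_zero {n : ℕ} {ν : Fin n → ℝ} (c : Fin n → ℝ) (hν : ∀ j, ∀ m : ℤ, ν j ≠ m) (x : ℝ) :
    powSum ν c 0 x = ∑ j, c j * x ^ ν j := by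
  refine Finset.sum_congr rfl fun j _ => ?_
  have hG : Real.Gamma (ν j + 1) ≠ 0 := Real.Gamma_ne_zero fun m hm =>
    hν j (-m - 1) (by push_cast; linarith)
  rw [Nat.cast_zero, sub_zero, sub_zero, div_self hG, mul_one]

/-- The endpoint estimates cover all but a compact subinterval, where `f` is bounded and `g ≥ 1`. -/
theorem exists_abs_le_mul_of_isBigO {f g : ℝ → ℝ} (hf : ContinuousOn f (Ioo (-1) 1))
    (hg : ∀ t ∈ Ioo (-1 : ℝ) 1, 1 ≤ g t) (h1 : f =O[𝓝[<] 1] g) (h2 : f =O[𝓝[>] (-1)] g) :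
    ∃ C, ∀ t ∈ Ioo (-1 : ℝ) 1, |f t| ≤ C * g t := by
  obtain ⟨C1, hC1⟩ := h1.bound
  obtain ⟨C2, hC2⟩ := h2.bound
  obtain ⟨a, ha, ha'⟩ := (mem_nhdsLT_iff_exists_Ioo_subset' (show (0 : ℝ) < 1 by norm_num)).1 hC1
  obtain ⟨b, hb, hb'⟩ := (mem_nhdsGT_iff_exists_Ioo_subset' (show (-1 : ℝ) < 0 by norm_num)).1 hC2
  obtain ⟨M, hM⟩ := isCompact_Icc.exists_bound_of_continuousOn (s := Icc b a)
    (hf.mono fun t ht => ⟨lt_of_lt_of_le hb ht.1, lt_of_le_of_lt ht.2 ha⟩)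
  refine ⟨max M (max C1 C2), fun t ht => ?_⟩
  have hgt := hg t ht
  have hg0 : |g t| = g t := abs_of_pos (by linarith)
  rcases lt_or_ge a t with h | h
  · have := ha' ⟨h, ht.2⟩
    simp only [mem_ofPred_eq, Real.norm_eq_abs, hg0] at this
    exact this.trans (mul_le_mul_of_nonneg_right ((le_max_left _ _).trans (le_max_right _ _))
      (by linarith))
  rcases lt_or_ge t b with h' | h'
  · have := hb' ⟨ht.1, h'⟩
    simp only [mem_ofPred_eq, Real.norm_eq_abs, hg0] at this
    exact this.trans (mul_le_mul_of_nonneg_right ((le_max_right _ _).trans (le_max_right _ _))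
      (by linarith))
  · have hMt := hM t ⟨h', h⟩
    have hM0 : 0 ≤ M := (norm_nonneg _).trans hMt
    calc |f t| ≤ M * 1 := by simpa using hMt
      _ ≤ max M (max C1 C2) * g t :=
        mul_le_mul (le_max_left _ _) hgt zero_le_one (hM0.trans (le_max_left _ _))

theorem isBigO_one_add_weight {f : ℝ → ℝ} {t₀ : ℝ} (hf : ContinuousAt f t₀) (σ : ℝ) {l : Filter ℝ}
    (hl : l ≤ 𝓝 t₀) (hI : ∀ᶠ t in l, t ∈ Ioo (-1 : ℝ) 1) :
    f =O[l] fun t => 1 + (1 - t ^ 2) ^ σ := by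
  refine ((hf.tendsto.mono_left hl).isBigO_one ℝ).trans (IsBigO.of_bound 1 ?_)
  filter_upwards [hI] with t ht
  have := Real.rpow_nonneg (one_sub_sq_pos ht).le σ
  rw [one_mul, norm_one, Real.norm_eq_abs]
  exact le_trans (by linarith) (le_abs_self _)

theorem mul_weight_isBigO {f : ℝ → ℝ} {t₀ : ℝ} (hf : ContinuousAt f t₀) (σ : ℝ) {l : Filter ℝ}
    (hl : l ≤ 𝓝 t₀) (hI : ∀ᶠ t in l, t ∈ Ioo (-1 : ℝ) 1) :
    (fun t => f t * (1 - t ^ 2) ^ σ) =O[l] fun t => 1 + (1 - t ^ 2) ^ σ := by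
  have h : (fun t : ℝ => (1 - t ^ 2) ^ σ) =O[l] fun t => 1 + (1 - t ^ 2) ^ σ := by
    refine IsBigO.of_bound 1 ?_
    filter_upwards [hI] with t ht
    have := Real.rpow_nonneg (one_sub_sq_pos ht).le σ
    rw [one_mul, Real.norm_eq_abs, Real.norm_eq_abs, abs_of_nonneg this, abs_of_nonneg] <;> linarith
  simpa using ((hf.tendsto.mono_left hl).isBigO_one ℝ).mul h

/-- The derivatives of what remains of `κ` after subtraction of its singular parts. -/
def remainder (κ : ℝ → ℝ) {n : ℕ} (ν c c' : Fin n → ℝ) (s : ℕ) (t : ℝ) : ℝ :=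
  iteratedDeriv s κ t - (-1) ^ s * powSum ν c s (1 - t) - powSum ν c' s (1 + t)

theorem hasDerivAt_iteratedDeriv {κ : ℝ → ℝ} (hκ : ContDiffOn ℝ ∞ κ (Ioo (-1) 1)) (s : ℕ) {t : ℝ}
    (ht : t ∈ Ioo (-1 : ℝ) 1) :
    HasDerivAt (iteratedDeriv s κ) (iteratedDeriv (s + 1) κ t) t := by
  rw [iteratedDeriv_succ, hasDerivAt_deriv_iff]
  have hI : Ioo (-1 : ℝ) 1 ∈ 𝓝 t := Ioo_mem_nhds ht.1 ht.2
  have h := (hκ.differentiableOn_iteratedDerivWithin (m := s)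
    (by exact_mod_cast ENat.natCast_lt_top s) isOpen_Ioo.uniqueDiffOn).differentiableAt hI
  exact h.congr_of_eventuallyEq
    (eventually_of_mem hI fun u hu => (iteratedDerivWithin_of_isOpen isOpen_Ioo hu).symm)

/-- Near each endpoint the polynomial and the powers centred at the other endpoint are bounded,
hence absorbed by the `1` in the bound. The polynomials for different `s` therefore need no relation
to each other. -/
theorem symbolChain_remainder {κ : ℝ → ℝ} {n : ℕ} {ν c c' : Fin n → ℝ} {ρ : ℝ}
    (hκ : ContDiffOn ℝ ∞ κ (Ioo (-1) 1)) (hν : ∀ j, ∀ m : ℤ, ν j ≠ m)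
    (h1 : HasExpansionAtOne κ ν c ρ) (h2 : HasExpansionAtNegOne κ ν c' ρ) :
    SymbolChain ρ (remainder κ ν c c') := by
  have hd : ∀ s, ∀ t ∈ Ioo (-1 : ℝ) 1,
      HasDerivAt (remainder κ ν c c' s) (remainder κ ν c c' (s + 1) t) t := by
    intro s t ht
    have e1 : HasDerivAt (fun u : ℝ => 1 - u) (-1) t := by
      simpa using (hasDerivAt_id t).const_sub 1
    have e2 : HasDerivAt (fun u : ℝ => 1 + u) 1 t := by
      simpa using (hasDerivAt_id t).const_add 1
    have e3 := (hasDerivAt_powSum c hν s (x := 1 - t) (by linarith [ht.2])).comp t e1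
    have e4 := (hasDerivAt_powSum c' hν s (x := 1 + t) (by linarith [ht.1])).comp t e2
    refine (((hasDerivAt_iteratedDeriv hκ s ht).sub (e3.const_mul ((-1) ^ s))).sub
      e4).congr_deriv ?_
    rw [remainder]
    ring
  refine ⟨hd, fun s => exists_abs_le_mul_of_isBigO
    (fun t ht => (hd s t ht).continuousAt.continuousWithinAt)
    (fun t ht => by linarith [Real.rpow_nonneg (one_sub_sq_pos ht).le (ρ - s)]) ?_ ?_⟩
  · obtain ⟨p, hp⟩ := h1 s
    have hI : ∀ᶠ t in 𝓝[<] (1 : ℝ), t ∈ Ioo (-1 : ℝ) 1 := Ioo_mem_nhdsLT (by norm_num)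
    have e1 : (fun t : ℝ => (1 - t) ^ (ρ - s)) =O[𝓝[<] 1]
        fun t => 1 + (1 - t ^ 2) ^ (ρ - s) := by
      -- `(1 - t)^σ = (1 + t)^(-σ) (1 - t²)^σ`, and the first factor is continuous at `1`.
      refine (mul_weight_isBigO (f := fun t : ℝ => (1 + t) ^ (-(ρ - s))) (t₀ := 1)
        (ContinuousAt.rpow_const (by fun_prop) (Or.inl (by norm_num))) (ρ - s)
        nhdsWithin_le_nhds hI).congr' ?_ EventuallyEq.rfl
      filter_upwards [hI] with t ht
      rw [one_sub_sq_rpow ht, mul_left_comm, ← Real.rpow_add (by linarith [ht.1]),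
        neg_add_cancel, Real.rpow_zero, mul_one]
    have e2 := isBigO_one_add_weight
      (f := fun t : ℝ => p.eval (1 - t) - powSum ν c' s (1 + t)) (t₀ := 1)
      ((p.continuous.comp (by fun_prop : Continuous fun t : ℝ => 1 - t)).continuousAt.sub
        (ContinuousAt.comp (f := fun t : ℝ => 1 + t) (continuousAt_powSum ν c' s (by norm_num))
          (by fun_prop)))
      (ρ - s) nhdsWithin_le_nhds hI
    refine ((hp.trans e1).add e2).congr_left fun t => ?_
    simp only [remainder, powSum, mul_assoc]
    ring
  · obtain ⟨p, hp⟩ := h2 s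
    have hI : ∀ᶠ t in 𝓝[>] (-1 : ℝ), t ∈ Ioo (-1 : ℝ) 1 := Ioo_mem_nhdsGT (by norm_num)
    have e1 : (fun t : ℝ => (1 + t) ^ (ρ - s)) =O[𝓝[>] (-1)]
        fun t => 1 + (1 - t ^ 2) ^ (ρ - s) := by
      refine (mul_weight_isBigO (f := fun t : ℝ => (1 - t) ^ (-(ρ - s))) (t₀ := -1)
        (ContinuousAt.rpow_const (by fun_prop) (Or.inl (by norm_num))) (ρ - s)
        nhdsWithin_le_nhds hI).congr' ?_ EventuallyEq.rfl
      filter_upwards [hI] with t ht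
      rw [one_sub_sq_rpow ht, ← mul_assoc, ← Real.rpow_add (by linarith [ht.2]),
        neg_add_cancel, Real.rpow_zero, one_mul]
    have e2 := isBigO_one_add_weight
      (f := fun t : ℝ => p.eval (1 + t) - (-1) ^ s * powSum ν c s (1 - t)) (t₀ := -1)
      ((p.continuous.comp (by fun_prop : Continuous fun t : ℝ => 1 + t)).continuousAt.sub
        ((ContinuousAt.comp (f := fun t : ℝ => 1 - t) (continuousAt_powSum ν c s (by norm_num))
          (by fun_prop)).const_mul ((-1) ^ s)))
      (ρ - s) nhdsWithin_le_nhds hI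
    refine ((hp.trans e1).add e2).congr_left fun t => ?_
    simp only [remainder, powSum]
    ring

/-- Here `ρ` is arbitrary: every derivative is bounded on the compact interval, so the constant `1`
in the bound suffices. -/
theorem symbolChain_of_contDiffOn_Icc {κ : ℝ → ℝ} (hκ : ContDiffOn ℝ ∞ κ (Icc (-1) 1)) (ρ : ℝ) :
    SymbolChain ρ fun s => iteratedDerivWithin s κ (Icc (-1) 1) where
  hasDerivAt s t ht := by
    have hu : UniqueDiffOn ℝ (Icc (-1 : ℝ) 1) := uniqueDiffOn_Icc (by norm_num)
    have h := hκ.differentiableOn_iteratedDerivWithin (m := s)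
      (by exact_mod_cast ENat.natCast_lt_top s) hu t (Ioo_subset_Icc_self ht)
    rw [iteratedDerivWithin_succ]
    exact h.hasDerivWithinAt.hasDerivAt (Icc_mem_nhds ht.1 ht.2)
  bound s := by
    have hu : UniqueDiffOn ℝ (Icc (-1 : ℝ) 1) := uniqueDiffOn_Icc (by norm_num)
    obtain ⟨C, hC⟩ := isCompact_Icc.exists_bound_of_continuousOn
      (hκ.continuousOn_iteratedDerivWithin (m := s) (by exact_mod_cast le_top) hu)
    refine ⟨C, fun t ht => (hC t (Ioo_subset_Icc_self ht)).trans ?_⟩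
    have hC0 : 0 ≤ C := (norm_nonneg _).trans (hC t (Ioo_subset_Icc_self ht))
    have := Real.rpow_nonneg (one_sub_sq_pos ht).le (ρ - s)
    exact le_mul_of_one_le_right hC0 (by linarith)

/-! ### Asymptotics of the eigenvalues. -/

theorem mercerEigenvalue_eq (d : ℕ) (κ : ℝ → ℝ) (k : ℕ) :
    mercerEigenvalue d κ k = sphereArea ((d : ℝ) - 2) / sphereArea ((d : ℝ) - 1) *
      ∫ t in (-1 : ℝ)..1, κ t * (gegenbauer k (((d : ℝ) - 3) / 2)).eval t *
        (1 - t ^ 2) ^ (((d : ℝ) - 3) / 2) := by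
  rw [mercerEigenvalue]
  congr 1
  refine intervalIntegral_congr_Ioo (by norm_num) fun t ht => ?_
  simp only [legendreP_eq_gegenbauer d k ht]

theorem sphereArea_pos {m : ℝ} (hm : -1 < m) : 0 < sphereArea m := by
  have := Real.Gamma_pos_of_pos (by linarith : 0 < (m + 1) / 2)
  have := Real.rpow_pos_of_pos Real.pi_pos ((m + 1) / 2)
  rw [sphereArea]
  positivity

/-- The two endpoints combine into the single coefficient `c j + (-1)^k * c' j` by the reflection `t
↦ -t`. -/
theorem integral_eq_remainder_add {κ : ℝ → ℝ} {n : ℕ} {ν c c' : Fin n → ℝ} {ρ α : ℝ}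
    (hF : SymbolChain ρ (remainder κ ν c c')) (hν : ∀ j, ∀ m : ℤ, ν j ≠ m) (hα : -1 < α)
    (hρ : -1 < ρ + α) (hνα : ∀ j, -1 < ν j + α) (k : ℕ) :
    ∫ t in (-1 : ℝ)..1, κ t * (gegenbauer k α).eval t * (1 - t ^ 2) ^ α =
      (∫ t in (-1 : ℝ)..1,
        remainder κ ν c c' 0 t * (gegenbauer k α).eval t * (1 - t ^ 2) ^ α) +
      ∑ j, (c j + (-1) ^ k * c' j) *
        ∫ t in (-1 : ℝ)..1, (1 - t) ^ ν j * (gegenbauer k α).eval t * (1 - t ^ 2) ^ α := by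
  set y := gegenbauer k α with hy
  have i1 := fun j => (intervalIntegrable_one_sub_rpow_mul hα (hνα j) y).const_mul (c j)
  have i2 := fun j => (intervalIntegrable_one_add_rpow_mul hα (hνα j) k).const_mul (c' j)
  have i3 := fun j => (i1 j).add (i2 j)
  have h : ∀ t : ℝ, κ t * y.eval t * (1 - t ^ 2) ^ α =
      remainder κ ν c c' 0 t * y.eval t * (1 - t ^ 2) ^ α +
      ∑ j, (c j * ((1 - t) ^ ν j * y.eval t * (1 - t ^ 2) ^ α) +
        c' j * ((1 + t) ^ ν j * y.eval t * (1 - t ^ 2) ^ α)) := by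
    intro t
    rw [remainder, iteratedDeriv_zero, powSum_zero c hν, powSum_zero c' hν, pow_zero, one_mul,
      Finset.sum_add_distrib]
    simp only [← mul_assoc, ← Finset.sum_mul]
    ring
  have isum := IntervalIntegrable.sum Finset.univ fun j _ => i3 j
  simp only [Finset.sum_fn] at isum
  simp only [h]
  rw [intervalIntegral.integral_add (hF.intervalIntegrable hα hρ y)
    isum,
    intervalIntegral.integral_finsetSum fun j _ => i3 j]
  congr 1
  refine Finset.sum_congr rfl fun j _ => ?_
  rw [intervalIntegral.integral_add (i1 j) (i2 j), intervalIntegral.integral_const_mul,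
    intervalIntegral.integral_const_mul, hy, integral_one_add_rpow_mul_gegenbauer]
  ring

theorem isBigO_add_neg_one_pow_mul (a b : ℝ) :
    (fun k : ℕ => a + (-1) ^ k * b) =O[atTop] fun _ : ℕ => (1 : ℝ) := by
  refine IsBigO.of_bound (|a| + |b|) (Eventually.of_forall fun k => ?_)
  rw [norm_one, mul_one]
  refine (abs_add_le _ _).trans ?_
  rw [abs_mul, abs_pow, abs_neg, abs_one, one_pow, one_mul]

/-- The leading singularities at both endpoints govern the Gegenbauer coefficients. -/
theorem integral_sub_isLittleO {κ : ℝ → ℝ} {r : ℕ} {ν c c' : Fin (r + 1) → ℝ} {ε α : ℝ}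
    (hα : -1 / 2 ≤ α) (hκ : ContDiffOn ℝ ∞ κ (Ioo (-1) 1)) (hν0 : 0 < ν 0) (hmono : StrictMono ν)
    (hν : ∀ j, ∀ m : ℤ, ν j ≠ m) (hε : 0 < ε) (h1 : HasExpansionAtOne κ ν c (ν 0 + 1 + ε))
    (h2 : HasExpansionAtNegOne κ ν c' (ν 0 + 1 + ε)) :
    (fun k : ℕ => (∫ t in (-1 : ℝ)..1, κ t * (gegenbauer k α).eval t * (1 - t ^ 2) ^ α) -
      (c 0 + (-1) ^ k * c' 0) * powerConst α (ν 0) * (k : ℝ) ^ (-(2 * ν 0 + 2 * α + 2))) =o[atTop]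
      fun k : ℕ => (k : ℝ) ^ (-(2 * ν 0 + 2 * α + 2)) := by
  have hF := symbolChain_remainder hκ hν h1 h2
  have hle : ∀ j, ν 0 ≤ ν j := fun j => hmono.monotone (Fin.zero_le j)
  have hνα : ∀ j, -1 < ν j + α := fun j => by linarith [hle j]
  have hα' : -1 < α := by linarith
  have hrem : (fun k : ℕ => ∫ t in (-1 : ℝ)..1,
      remainder κ ν c c' 0 t * (gegenbauer k α).eval t * (1 - t ^ 2) ^ α) =o[atTop]
      fun k : ℕ => (k : ℝ) ^ (-(2 * ν 0 + 2 * α + 2)) := by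
    have hpos : 0 ≤ ν 0 + α + 1 := by linarith
    have hm1 := Nat.lt_floor_add_one (ν 0 + α + 1)
    have hm2 := Nat.floor_le hpos
    -- With `m = ⌊ν 0 + α + 1⌋₊ + 1` one has `ν 0 + α + 1 < m ≤ ν 0 + α + 2 < ρ + α + 1`: the first
    -- inequality makes the remainder negligible, the last makes `m` admissible, thanks to `ε > 0`.
    refine (hF.integral_isBigO hα (⌊ν 0 + α + 1⌋₊ + 1) (by push_cast; linarith)).trans_isLittleO
      (rpow_natCast_isLittleO ?_)
    push_cast
    linarith
  have hsum : (fun k : ℕ => ∑ j : Fin r, (c j.succ + (-1) ^ k * c' j.succ) *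
      ∫ t in (-1 : ℝ)..1, (1 - t) ^ ν j.succ * (gegenbauer k α).eval t * (1 - t ^ 2) ^ α)
      =o[atTop] fun k : ℕ => (k : ℝ) ^ (-(2 * ν 0 + 2 * α + 2)) := by
    refine IsLittleO.fun_sum fun j _ => ?_
    have e1 := integral_one_sub_rpow_mul_gegenbauer_isLittleO hα' (hνα j.succ) (hν j.succ)
    have hlt : ν 0 < ν j.succ := hmono (Fin.succ_pos j)
    have e2 := rpow_natCast_isLittleO (a := -(2 * ν j.succ + 2 * α + 2))
      (b := -(2 * ν 0 + 2 * α + 2)) (by linarith)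
    have e3 := (e1.trans e2).add (e2.const_mul_left (powerConst α (ν j.succ)))
    simp only [sub_add_cancel] at e3
    simpa using (isBigO_add_neg_one_pow_mul (c j.succ) (c' j.succ)).mul_isLittleO e3
  have hmain := (isBigO_add_neg_one_pow_mul (c 0) (c' 0)).mul_isLittleO
    (integral_one_sub_rpow_mul_gegenbauer_isLittleO hα' (hνα 0) (hν 0))
  simp only [one_mul] at hmain
  refine ((hrem.add hsum).add hmain).congr_left fun k => ?_
  rw [integral_eq_remainder_add hF hν hα' (by linarith) hνα k, Fin.sum_univ_succ]
  ring

/-- The constant in the asymptotics of the eigenvalues. -/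
def eigenvalueConst (d : ℕ) (ν : ℝ) : ℝ :=
  sphereArea ((d : ℝ) - 2) / sphereArea ((d : ℝ) - 1) * powerConst (((d : ℝ) - 3) / 2) ν

theorem eigenvalueConst_ne_zero {d : ℕ} {ν : ℝ} (hd : 2 ≤ d) (hν : 0 < ν)
    (hν' : ∀ m : ℤ, ν ≠ m) : eigenvalueConst d ν ≠ 0 := by
  have hd' : (2 : ℝ) ≤ d := by exact_mod_cast hd
  exact mul_ne_zero (div_pos (sphereArea_pos (by linarith)) (sphereArea_pos (by linarith))).ne'
    (powerConst_ne_zero (by linarith) (by linarith) hν')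

theorem mercerEigenvalue_sub_isLittleO {d : ℕ} {κ : ℝ → ℝ} {r : ℕ} {ν c c' : Fin (r + 1) → ℝ}
    {ε : ℝ} (hd : 2 ≤ d) (hκ : ContDiffOn ℝ ∞ κ (Ioo (-1) 1)) (hν0 : 0 < ν 0)
    (hmono : StrictMono ν) (hν : ∀ j, ∀ m : ℤ, ν j ≠ m) (hε : 0 < ε)
    (h1 : HasExpansionAtOne κ ν c (ν 0 + 1 + ε)) (h2 : HasExpansionAtNegOne κ ν c' (ν 0 + 1 + ε)) :
    (fun k : ℕ => mercerEigenvalue d κ k -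
      (c 0 + (-1) ^ k * c' 0) * eigenvalueConst d (ν 0) * (k : ℝ) ^ (-(d : ℝ) - 2 * ν 0 + 1))
      =o[atTop] fun k : ℕ => (k : ℝ) ^ (-(d : ℝ) - 2 * ν 0 + 1) := by
  have hd' : (2 : ℝ) ≤ d := by exact_mod_cast hd
  have h := (integral_sub_isLittleO (α := ((d : ℝ) - 3) / 2) (by linarith) hκ hν0 hmono hν hε h1
    h2).const_mul_left (sphereArea ((d : ℝ) - 2) / sphereArea ((d : ℝ) - 1))
  rw [show -(2 * ν 0 + 2 * (((d : ℝ) - 3) / 2) + 2) = -(d : ℝ) - 2 * ν 0 + 1 by ring] at h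
  refine h.congr_left fun k => ?_
  rw [mercerEigenvalue_eq, eigenvalueConst]
  ring

/-- Passing from `u k = (a + (-1)^k b) C v k + o(v k)` to a filter on which `(-1)^k` is
constant. -/
theorem isEquivalent_and_isLittleO_of_sub_isLittleO {u v : ℕ → ℝ} {a b C σ : ℝ} {l : Filter ℕ}
    (hl : l ≤ atTop) (hσ : ∀ᶠ k in l, (-1 : ℝ) ^ k = σ) (hC : C ≠ 0)
    (h : (fun k => u k - (a + (-1) ^ k * b) * C * v k) =o[atTop] v) :
    (a + σ * b ≠ 0 → u ~[l] fun k => (a + σ * b) * C * v k) ∧ (a + σ * b = 0 → u =o[l] v) := by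
  have h' : (fun k => u k - (a + σ * b) * C * v k) =o[l] v := by
    refine (h.mono hl).congr' ?_ EventuallyEq.rfl
    filter_upwards [hσ] with k hk
    rw [hk]
  refine ⟨fun hne => ?_, fun h0 => ?_⟩
  · exact h'.trans_isBigO ((isBigO_refl v l).const_mul_right (mul_ne_zero hne hC))
  · simpa [h0] using h'

theorem superpolynomialDecay_mercerEigenvalue {d : ℕ} {κ : ℝ → ℝ} (hd : 2 ≤ d)
    (hκ : ContDiffOn ℝ ∞ κ (Icc (-1) 1)) :
    SuperpolynomialDecay atTop (fun k : ℕ => (k : ℝ)) (mercerEigenvalue d κ) := by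
  have hd' : (2 : ℝ) ≤ d := by exact_mod_cast hd
  intro n
  have hα : -1 / 2 ≤ ((d : ℝ) - 3) / 2 := by linarith
  -- Order `n + 1` allows `m = n + 1` because `α + 1 > 0`; the resulting `k^(-2(n + 1))` beats
  -- `k^(-n)`.
  have h := (symbolChain_of_contDiffOn_Icc hκ (n + 1)).integral_isBigO hα (n + 1)
    (by push_cast; linarith)
  simp only [iteratedDerivWithin_zero] at h
  have h2 : mercerEigenvalue d κ =o[atTop] fun k : ℕ => (k : ℝ) ^ (-(n : ℝ)) := by
    refine IsBigO.trans_isLittleO ?_ (rpow_natCast_isLittleO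
      (a := -(2 * ((n + 1 : ℕ) : ℝ))) (by push_cast; linarith [n.cast_nonneg (α := ℝ)]))
    exact (h.const_mul_left _).congr_left fun k => (mercerEigenvalue_eq d κ k).symm
  have h3 := h2.tendsto_div_nhds_zero
  refine h3.congr fun k => ?_
  rw [Real.rpow_neg k.cast_nonneg, Real.rpow_natCast, div_inv_eq_mul, mul_comm]

end DotProduct

end

theorem theorem1 :
    ∃ C : ℕ → ℝ → ℝ,
      (∀ (d : ℕ) (a : ℝ), 2 ≤ d → 0 < a → (∀ m : ℤ, a ≠ m) → C d a ≠ 0) ∧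
      (∀ (d : ℕ) (κ : ℝ → ℝ) (r : ℕ) (ν cpos cneg : Fin (r + 1) → ℝ) (ε : ℝ),
        2 ≤ d →
        ContDiffOn ℝ ∞ κ (Ioo (-1) 1) →
        0 < ν 0 → StrictMono ν → (∀ j, ∀ m : ℤ, ν j ≠ m) →
        0 < ε →
        DotProduct.HasExpansionAtOne κ ν cpos (ν 0 + 1 + ε) →
        DotProduct.HasExpansionAtNegOne κ ν cneg (ν 0 + 1 + ε) →
        (cpos 0 ≠ -cneg 0 →
          DotProduct.mercerEigenvalue d κ ~[DotProduct.evenAtTop]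
            fun k : ℕ => (cpos 0 + cneg 0) * C d (ν 0) * (k : ℝ) ^ (-(d : ℝ) - 2 * ν 0 + 1)) ∧
        (cpos 0 = -cneg 0 →
          DotProduct.mercerEigenvalue d κ =o[DotProduct.evenAtTop]
            fun k : ℕ => (k : ℝ) ^ (-(d : ℝ) - 2 * ν 0 + 1)) ∧
        (cpos 0 ≠ cneg 0 →
          DotProduct.mercerEigenvalue d κ ~[DotProduct.oddAtTop]
            fun k : ℕ => (cpos 0 - cneg 0) * C d (ν 0) * (k : ℝ) ^ (-(d : ℝ) - 2 * ν 0 + 1)) ∧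
        (cpos 0 = cneg 0 →
          DotProduct.mercerEigenvalue d κ =o[DotProduct.oddAtTop]
            fun k : ℕ => (k : ℝ) ^ (-(d : ℝ) - 2 * ν 0 + 1))) ∧
      (∀ (d : ℕ) (κ : ℝ → ℝ), 2 ≤ d → ContDiffOn ℝ ∞ κ (Icc (-1) 1) →
        SuperpolynomialDecay atTop (fun k : ℕ => (k : ℝ)) (DotProduct.mercerEigenvalue d κ)) := by
  refine ⟨DotProduct.eigenvalueConst,
    fun d a hd ha ha' => DotProduct.eigenvalueConst_ne_zero hd ha ha', ?_,
    fun d κ hd hκ => DotProduct.superpolynomialDecay_mercerEigenvalue hd hκ⟩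
  intro d κ r ν c c' ε hd hκ hν0 hmono hν hε h1 h2
  have h := DotProduct.mercerEigenvalue_sub_isLittleO hd hκ hν0 hmono hν hε h1 h2
  have hC := DotProduct.eigenvalueConst_ne_zero hd hν0 (hν 0)
  obtain ⟨e1, e2⟩ := DotProduct.isEquivalent_and_isLittleO_of_sub_isLittleO
    (l := DotProduct.evenAtTop) (σ := 1) inf_le_left
    (mem_inf_of_right fun k (hk : Even k) => hk.neg_one_pow) hC h
  obtain ⟨o1, o2⟩ := DotProduct.isEquivalent_and_isLittleO_of_sub_isLittleO
    (l := DotProduct.oddAtTop) (σ := -1) inf_le_left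
    (mem_inf_of_right fun k (hk : Odd k) => hk.neg_one_pow) hC h
  rw [one_mul] at e1 e2
  rw [neg_one_mul, ← sub_eq_add_neg] at o1 o2
  exact ⟨fun hne => e1 fun h0 => hne (eq_neg_of_add_eq_zero_left h0),
    fun heq => e2 (by rw [heq, neg_add_cancel]), fun hne => o1 (sub_ne_zero.2 hne),
    fun heq => o2 (sub_eq_zero.2 heq)⟩
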